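/- Let $\mathbb M$ be a graded group, that is, a real, finite dimensional, connected and simply connected Lie group whose Lie algebra is a direct sum $\mathcal M=V_1\oplus\cdots\oplus V_\upsilon$ with $[V_i,V_j]\subset V_{i+j}$ for all $i,j\ge 1$ (where $V_k=\{0\}$ for $k>\upsilon$). Let $\pi_i:\mathcal M\to V_i$ be the canonical projections, let $\delta_r X=\sum_{i=1}^{\upsilon} r^i\pi_i(X)$ for $r>0$ be the dilations of $\mathcal M$, also read in $\mathbb M$ through the exponential map $\exp:\mathcal M\to\mathbb M$, and set $[X,Y]_0=Y$ and $[X,Y]_{k+1}=[X,[X,Y]_k]$. Let $\rho$ be a homogeneous distance on $\mathbb M$, that is, a continuous left invariant distance with $\rho(\delta_r x,\delta_r y)=r\,\rho(x,y)$ for all $x,y\in\mathbb M$ and $r>0$, and let $\|\cdot\|$ be a norm on $\mathcal M$. Let $\Gamma:[a,b]\to\mathbb M$ be a curve and let $\gamma:[a,b]\to\mathcal M$ be such that $\Gamma=\exp\circ\gamma$; put $\gamma_i=\pi_i\circ\gamma$. Then the following statements are equivalent: 1. $\Gamma$ is absolutely continuous with respect to $\rho$; 2. $\gamma$ is absolutely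 continuous with respect to $\|\cdot\|$ and, for every $i\ge 2$, the equation $$\dot\gamma_i(t)=\sum_{n=2}^{\upsilon}\frac{(-1)^n}{n!}\,\pi_i\big([\gamma(t),\dot\gamma(t)]_{n-1}\big)$$ holds for almost every $t\in[a,b]$. Moreover, there is a constant $C>0$, depending only on the graded group, $\rho$ and $\|\cdot\|$ (and not on $a,b,\Gamma,\gamma$), such that whenever one of these conditions holds, $$\rho\big(\Gamma(\tau_1),\Gamma(\tau_2)\big)\le C\int_{\tau_1}^{\tau_2}\|\dot\gamma_1(t)\|\,dt\qquad\text{for all } a\le\tau_1<\tau_2\le b.$$ -/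

import Mathlib

open Set Filter Topology MeasureTheory
open scoped Manifold ContDiff

/-- In real smoothness classes, `minSmoothness ℝ 3 = 3 ≤ ∞`; with this instance a smooth real Lie
group satisfies the regularity assumption under which Mathlib puts a Lie algebra structure on the
tangent space at the identity. -/
instance instLEInftyMinSmoothnessThree : ENat.LEInfty (minSmoothness ℝ 3) :=
  ⟨by rw [minSmoothness_of_isRCLikeNormedField]; exact ENat.LEInfty.out⟩

namespace GradedGroup

section AbsolutelyContinuous

variable {X : Type*}

/-- Absolute continuity on `[a, b]` of a curve `f` with respect to a distance function `d`: for
finite families of disjoint subintervals of `[a, b]`, the sum of the distances between the images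
of the endpoints tends to zero as the total length of the family tends to zero. -/
def AbsContWrt (d : X → X → ℝ) (f : ℝ → X) (a b : ℝ) : Prop :=
  Tendsto (fun F : ℕ × (ℕ → ℝ × ℝ) => ∑ i ∈ Finset.range F.1, d (f (F.2 i).1) (f (F.2 i).2))
    (AbsolutelyContinuousOnInterval.totalLengthFilter ⊓
      𝓟 (AbsolutelyContinuousOnInterval.disjWithin a b)) (𝓝 0)

/-- For the distance of a (pseudo)metric space this is Mathlib's absolute continuity. -/
theorem absContWrt_dist_iff [PseudoMetricSpace X] (f : ℝ → X) (a b : ℝ) :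
    AbsContWrt dist f a b ↔ AbsolutelyContinuousOnInterval f a b := Iff.rfl

end AbsolutelyContinuous

section Algebra

variable {L : Type*} [LieRing L]

/-- The `k`-th iterated bracket `[X, Y]_k = [X, [X, ⋯ [X, Y]⋯]]` (with `k` copies of `X`), so that
`[X, Y]_0 = Y`. -/
def iterBracket (X Y : L) (k : ℕ) : L := (fun Z => ⁅X, Z⁆)^[k] Y

variable [LieAlgebra ℝ L] (V : ℕ → Submodule ℝ L) [GradedLieAlgebra V]

/-- The canonical projection `π_i` onto the layer `V_i` of a graded Lie algebra. -/
def layerProj (i : ℕ) (X : L) : L := (DirectSum.decompose V X i : L)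

/-- The dilation `δ_r` of a graded Lie algebra with layers `V_1, …, V_υ`, i.e. the linear map that
is multiplication by `r ^ i` on `V_i`. -/
def dilation (υ : ℕ) (r : ℝ) (X : L) : L := ∑ i ∈ Finset.Icc 1 υ, r ^ i • layerProj V i X

end Algebra

section LieGroups

variable {E : Type*} [NormedAddCommGroup E] [NormedSpace ℝ E]
  {G : Type*} [TopologicalSpace G] [ChartedSpace E G] [Group G]

open Classical in
/-- The exponential map of a Lie group: `exp X = φ 1`, where `φ` is the integral curve of the
left-invariant vector field of `X` with `φ 0 = 1`. Such a curve exists and is unique in a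
Hausdorff Lie group (see the two facts below), so the second branch is never used. -/
noncomputable def lieExp (X : GroupLieAlgebra 𝓘(ℝ, E) G) : G :=
  if h : ∃ φ : ℝ → G, IsMIntegralCurve (I := 𝓘(ℝ, E)) φ (mulInvariantVectorField X) ∧ φ 0 = 1 then
    h.choose 1
  else 1

theorem contMDiff_leftInvariant [LieGroup 𝓘(ℝ, E) ∞ G] (X : GroupLieAlgebra 𝓘(ℝ, E) G) :
    ContMDiff 𝓘(ℝ, E) 𝓘(ℝ, E).tangent 1
      (fun g : G => (⟨g, mulInvariantVectorField X g⟩ : TangentBundle 𝓘(ℝ, E) G)) :=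
  (contMDiff_mulInvariantVectorField X).of_le
    (by rw [minSmoothness_of_isRCLikeNormedField]; norm_num)

variable [CompleteSpace E] [LieGroup 𝓘(ℝ, E) ∞ G]

/-- The integral curve in the definition of the exponential map always exists. -/
theorem exists_oneParameterCurve [T2Space G] (X : GroupLieAlgebra 𝓘(ℝ, E) G) :
    ∃ φ : ℝ → G, IsMIntegralCurve (I := 𝓘(ℝ, E)) φ (mulInvariantVectorField X) ∧ φ 0 = 1 := by
  obtain ⟨φ, h0, hφ⟩ := exists_isMIntegralCurveAt_of_contMDiffAt_boundaryless (t₀ := 0)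
    (contMDiff_leftInvariant X).contMDiffAt (x₀ := (1 : G))
  obtain ⟨ε, hε, h⟩ := isMIntegralCurveAt_iff'.1 hφ
  rw [Real.ball_eq_Ioo, zero_sub, zero_add] at h
  have key : ∀ g : G, ∃ c : ℝ → G, c 0 = g ∧
      IsMIntegralCurveOn (I := 𝓘(ℝ, E)) c (mulInvariantVectorField X) (Ioo (-ε) ε) := by
    refine fun g => ⟨fun t => g * φ t, by simp [h0], fun t ht => ?_⟩
    have hd : ∀ k l : G, MDifferentiableAt 𝓘(ℝ, E) 𝓘(ℝ, E) (k * ·) l := fun k l =>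
      (contMDiff_mul_left (I := 𝓘(ℝ, E)) (n := ∞)).mdifferentiableAt (by simp)
    have h2 := (hd g (φ t)).hasMFDerivAt.comp_hasMFDerivWithinAt t (h t ht)
    have h3 : mulInvariantVectorField X (g * φ t) =
        mfderiv 𝓘(ℝ, E) 𝓘(ℝ, E) (g * ·) (φ t) (mulInvariantVectorField X (φ t)) := by
      have h4 : (g * φ t * ·) = (g * ·) ∘ (φ t * ·) := by ext; simp [mul_assoc]
      rw [mulInvariantVectorField, h4]
      exact mfderiv_comp_apply_of_eq 1 (hd _ _) (hd _ _) (mul_one _) X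
    have h5 : (ContinuousLinearMap.smulRight (1 : ℝ →L[ℝ] ℝ)
        (mulInvariantVectorField X (g * φ t)) : ℝ →L[ℝ] TangentSpace 𝓘(ℝ, E) (g * φ t)) =
        (mfderiv 𝓘(ℝ, E) 𝓘(ℝ, E) (g * ·) (φ t)).comp (ContinuousLinearMap.smulRight
          (1 : ℝ →L[ℝ] ℝ) (mulInvariantVectorField X (φ t))) := by
      rw [h3]
      ext
      simp
    exact (congrArg (fun T => HasMFDerivWithinAt 𝓘(ℝ, ℝ) 𝓘(ℝ, E) (fun t => g * φ t)
      (Ioo (-ε) ε) t T) h5).mpr h2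
  obtain ⟨ψ, hψ, hψ'⟩ := exists_isMIntegralCurve_of_isMIntegralCurveOn (contMDiff_leftInvariant X) hε key 1
  exact ⟨ψ, hψ', hψ⟩

/-- The exponential map does not depend on the choice of that integral curve. -/
theorem lieExp_eq [T2Space G] (X : GroupLieAlgebra 𝓘(ℝ, E) G) (φ : ℝ → G)
    (h : IsMIntegralCurve (I := 𝓘(ℝ, E)) φ (mulInvariantVectorField X)) (h0 : φ 0 = 1) :
    lieExp X = φ 1 := by
  have hex : ∃ φ : ℝ → G, IsMIntegralCurve (I := 𝓘(ℝ, E)) φ (mulInvariantVectorField X) ∧ φ 0 = 1 :=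
    ⟨φ, h, h0⟩
  rw [lieExp, dif_pos hex]
  exact congrFun (isMIntegralCurve_Ioo_eq_of_contMDiff_boundaryless (t₀ := 0) (contMDiff_leftInvariant X)
    hex.choose_spec.1 h (hex.choose_spec.2.trans h0.symm)) 1

/-- A homogeneous distance on the graded group `G` whose Lie algebra has the layers
`V_1, …, V_υ`: a distance that is continuous for the topology of `G`, left invariant, and
homogeneous for the dilations, which are read in `G` through the exponential map. -/
structure IsHomogeneousDistance (V : ℕ → Submodule ℝ (GroupLieAlgebra 𝓘(ℝ, E) G))
    [GradedLieAlgebra V] (υ : ℕ) (ρ : G → G → ℝ) : Prop where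
  eq_zero_iff : ∀ x y, ρ x y = 0 ↔ x = y
  symm : ∀ x y, ρ x y = ρ y x
  triangle : ∀ x y z, ρ x z ≤ ρ x y + ρ y z
  continuous : Continuous fun p : G × G => ρ p.1 p.2
  left_invariant : ∀ z x y, ρ (z * x) (z * y) = ρ x y
  homogeneous : ∀ r : ℝ, 0 < r → ∀ X Y : GroupLieAlgebra 𝓘(ℝ, E) G,
    ρ (lieExp (dilation V υ r X)) (lieExp (dilation V υ r Y)) = r * ρ (lieExp X) (lieExp Y)

/-- The system of contact equations
`γ̇_i(t) = ∑_{n=2}^υ ((-1)^n / n!) π_i([γ(t), γ̇(t)]_{n-1})`, for a.e. `t ∈ [a, b]` and every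
`i ≥ 2`, where `γ_i = π_i ∘ γ`. -/
def ContactEquations (V : ℕ → Submodule ℝ (GroupLieAlgebra 𝓘(ℝ, E) G)) [GradedLieAlgebra V]
    (υ : ℕ) (γ : ℝ → GroupLieAlgebra 𝓘(ℝ, E) G) (a b : ℝ) : Prop :=
  ∀ i : ℕ, 2 ≤ i → ∀ᵐ t ∂(volume.restrict (Icc a b)),
    deriv (fun s => layerProj V i (γ s)) t =
      ∑ n ∈ Finset.Icc 2 υ, ((-1 : ℝ) ^ n / (n.factorial : ℝ)) •
        layerProj V i (iterBracket (γ t) (deriv γ t) (n - 1))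

end LieGroups

end GradedGroup

/-! Put F(X) = Σ_k (-1)^k (ad X)^k / (k+1)!, that is (1 - exp(-ad X)) / ad X. The sum is finite
because the grading makes ad X nilpotent; it is `negExpPrimitive` at s = 1. F is the left
logarithmic derivative of exp: where γ is differentiable, the velocity of exp ∘ γ translated back to
the identity is F(γ)γ'. Expanding F, the contact equations say exactly that π_j(F(γ)γ') = 0 for all
j ≥ 2, so the velocity is horizontal almost everywhere (`IsGrading.contact_iff`).

The formula for F comes from the curve s ↦ exp(-sX) exp(sX'), whose logarithmic derivative is exp(-s
ad X')(X' - X). Integrating over [0, 1] gives exp(-X) exp(X') ≈ F(X')(X' - X) with a quadratic error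
(`exists_bound_inv_mul`), hence strict differentiability of exp (`hasStrictFDerivAt`). F(X) is the
identity plus terms raising the degree, so it is invertible and exp is a local homeomorphism.
Homogeneity of ρ makes exp injective, compactness of bounded sets makes its range closed, and
connectedness makes it surjective. Thus everything can be computed in exponential coordinates, where
left translations are Lipschitz on bounded sets and preserve F(γ)γ'.

Scaling to a compact set compares ρ(1, exp X) with the quantities ‖π_j X‖^(1/j)
(`exists_norm_proj_le`, `exists_le_of_norm_proj_le`).

If Γ is absolutely continuous for ρ, this comparison makes γ absolutely continuous. At almost every
t also ρ(Γ(t), Γ(s)) = O(|s - t|), so the degree j component of log(Γ(t)⁻¹Γ(s)) is O(|s - t|^j). For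
j ≥ 2 its derivative at t vanishes, and this derivative is π_j(F(γ)γ')
(`absolutelyContinuous_and_horizontal`).

Conversely, translate a horizontal curve so that it starts at 0, and let L be the integral of
‖γ_1'‖. The contact equations express the degree j velocity through lower degrees, so induction on j
bounds the degree j coordinate by a constant times L^j. The comparison gives ρ ≤ C·L on every
subinterval (`exists_dist_le_integral`), which is both the final estimate and the absolute
continuity of Γ. -/

namespace GradedGroup

/-- A chart of a group at the identity in which multiplication and conjugation are smooth. -/
structure IsIdentityChart {E G : Type*} [NormedAddCommGroup E] [NormedSpace ℝ E]
    [TopologicalSpace G] [Group G] (κ : OpenPartialHomeomorph G E) : Prop where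
  one_mem : 1 ∈ κ.source
  map_one : κ 1 = 0
  contDiffAt_mul : ContDiffAt ℝ 2 (fun p : E × E => κ (κ.symm p.1 * κ.symm p.2)) (0, 0)
  contDiffAt_conj : ∀ g : G, ContDiffAt ℝ 1 (fun x => κ (g * κ.symm x * g⁻¹)) 0

/-! ### Translation derivatives and the bracket in a chart -/

section Bracket

variable {E G : Type*} [NormedAddCommGroup E] [NormedSpace ℝ E] [TopologicalSpace G] [Group G]

/-- The derivative at the identity of left multiplications, in a chart. -/
noncomputable def leftDeriv (κ : OpenPartialHomeomorph G E) (x : E) : E →L[ℝ] E :=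
  fderiv ℝ (fun y => κ (κ.symm x * κ.symm y)) 0

/-- The derivative at the identity of right multiplications, in a chart. -/
noncomputable def rightDeriv (κ : OpenPartialHomeomorph G E) (x : E) : E →L[ℝ] E :=
  fderiv ℝ (fun y => κ (κ.symm y * κ.symm x)) 0

/-- The Lie bracket on the model space of a group, computed in a chart at the identity. -/
noncomputable def chartBracket (κ : OpenPartialHomeomorph G E) : E →L[ℝ] E →L[ℝ] E :=
  fderiv ℝ (leftDeriv κ) 0 - (fderiv ℝ (leftDeriv κ) 0).flip

end Bracket

/-! ### The preferred chart at the identity of a Lie group -/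

section Chart

variable (E : Type*) [NormedAddCommGroup E] [NormedSpace ℝ E]
  (G : Type*) [TopologicalSpace G] [ChartedSpace E G] [Group G]

/-- The preferred chart at the identity, translated so that it maps the identity to zero. -/
noncomputable def idChart : OpenPartialHomeomorph G E :=
  (chartAt E (1 : G)).transHomeomorph (Homeomorph.addRight (-(chartAt E (1 : G) 1)))

variable {E G}

theorem idChart_apply (g : G) :
    idChart E G g = extChartAt 𝓘(ℝ, E) (1 : G) g - extChartAt 𝓘(ℝ, E) (1 : G) 1 := by
  simp [idChart, sub_eq_add_neg]

theorem idChart_symm_apply (x : E) :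
    (idChart E G).symm x =
      (extChartAt 𝓘(ℝ, E) (1 : G)).symm (x + extChartAt 𝓘(ℝ, E) (1 : G) 1) := by
  simp [idChart, Homeomorph.addRight_symm]

omit [NormedSpace ℝ E] in
theorem one_mem_idChart_source : (1 : G) ∈ (idChart E G).source := by
  simp [idChart]

theorem idChart_one : idChart E G 1 = 0 := by simp [idChart_apply]

theorem idChart_symm_zero : (idChart E G).symm 0 = 1 := by
  simp [idChart_symm_apply]

theorem contMDiffAt_idChart_symm [LieGroup 𝓘(ℝ, E) ∞ G] :
    ContMDiffAt 𝓘(ℝ, E) 𝓘(ℝ, E) ∞ (idChart E G).symm 0 := by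
  have h : ((idChart E G).symm : E → G) =
      (extChartAt 𝓘(ℝ, E) (1 : G)).symm ∘ fun x => x + extChartAt 𝓘(ℝ, E) (1 : G) 1 :=
    funext idChart_symm_apply
  rw [h]
  refine ContMDiffAt.comp (I' := 𝓘(ℝ, E)) (0 : E) ?_
    (contDiffAt_id.add contDiffAt_const).contMDiffAt
  refine (contMDiffOn_extChartAt_symm (n := ∞) (1 : G)).contMDiffAt ?_
  simpa using extChartAt_target_mem_nhds (I := 𝓘(ℝ, E)) (1 : G)

theorem contMDiffAt_idChart [LieGroup 𝓘(ℝ, E) ∞ G] :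
    ContMDiffAt 𝓘(ℝ, E) 𝓘(ℝ, E) ∞ (idChart E G) 1 := by
  have h : (idChart E G : G → E) = (fun x => x - extChartAt 𝓘(ℝ, E) (1 : G) 1) ∘
      extChartAt 𝓘(ℝ, E) (1 : G) := funext idChart_apply
  rw [h]
  exact ContMDiffAt.comp (I' := 𝓘(ℝ, E)) (1 : G)
    (contDiffAt_id.sub contDiffAt_const).contMDiffAt contMDiffAt_extChartAt

theorem isIdentityChart_idChart [LieGroup 𝓘(ℝ, E) ∞ G] : IsIdentityChart (idChart E G) where
  one_mem := one_mem_idChart_source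
  map_one := idChart_one
  contDiffAt_mul := by
    have h1 : ContMDiffAt 𝓘(ℝ, E × E) 𝓘(ℝ, E) ∞ (fun p : E × E => (idChart E G).symm p.1) (0, 0) :=
      ContMDiffAt.comp (I' := 𝓘(ℝ, E)) ((0, 0) : E × E)
        (f := Prod.fst) contMDiffAt_idChart_symm contDiffAt_fst.contMDiffAt
    have h2 : ContMDiffAt 𝓘(ℝ, E × E) 𝓘(ℝ, E) ∞ (fun p : E × E => (idChart E G).symm p.2) (0, 0) :=
      ContMDiffAt.comp (I' := 𝓘(ℝ, E)) ((0, 0) : E × E)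
        (f := Prod.snd) contMDiffAt_idChart_symm contDiffAt_snd.contMDiffAt
    have h3 := ContMDiffAt.comp_of_eq (y := (1 : G)) contMDiffAt_idChart (h1.mul h2)
      (by simp [idChart_symm_zero])
    exact (contMDiffAt_iff_contDiffAt.1 h3).of_le (ENat.LEInfty.out)
  contDiffAt_conj g := by
    have h1 : ContMDiffAt 𝓘(ℝ, E) 𝓘(ℝ, E) ∞
        (fun x : E => g * (idChart E G).symm x * g⁻¹) 0 :=
      (contMDiffAt_const.mul contMDiffAt_idChart_symm).mul contMDiffAt_const
    have h3 := ContMDiffAt.comp_of_eq (y := (1 : G)) contMDiffAt_idChart h1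
      (by simp [idChart_symm_zero])
    exact (contMDiffAt_iff_contDiffAt.1 h3).of_le (by exact_mod_cast le_top)

end Chart

/-! ### One-parameter subgroups -/

section Exp

variable {E : Type*} [NormedAddCommGroup E] [NormedSpace ℝ E]
  {G : Type*} [TopologicalSpace G] [ChartedSpace E G] [Group G]

/-- The exponential map, read on the model space. -/
noncomputable def expMap (X : E) : G := lieExp (E := E) (G := G) X

variable [CompleteSpace E] [LieGroup 𝓘(ℝ, E) ∞ G]

omit [CompleteSpace E] in
theorem IsMIntegralCurve.mul_left {X : GroupLieAlgebra 𝓘(ℝ, E) G} {φ : ℝ → G}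
    (h : IsMIntegralCurve (I := 𝓘(ℝ, E)) φ (mulInvariantVectorField X)) (g : G) :
    IsMIntegralCurve (I := 𝓘(ℝ, E)) (fun t => g * φ t) (mulInvariantVectorField X) := by
  intro t
  have hd : ∀ k l : G, MDifferentiableAt 𝓘(ℝ, E) 𝓘(ℝ, E) (k * ·) l := fun k l =>
    (contMDiff_mul_left (I := 𝓘(ℝ, E)) (n := ∞)).mdifferentiableAt (by simp)
  have h2 := (hd g (φ t)).hasMFDerivAt.comp t (h t)
  have h3 : mulInvariantVectorField X (g * φ t) =
      mfderiv 𝓘(ℝ, E) 𝓘(ℝ, E) (g * ·) (φ t) (mulInvariantVectorField X (φ t)) := by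
    have h4 : (g * φ t * ·) = (g * ·) ∘ (φ t * ·) := by ext; simp [mul_assoc]
    rw [mulInvariantVectorField, h4]
    exact mfderiv_comp_apply_of_eq 1 (hd _ _) (hd _ _) (mul_one _) X
  have h5 : (ContinuousLinearMap.smulRight (1 : ℝ →L[ℝ] ℝ)
      (mulInvariantVectorField X (g * φ t)) : ℝ →L[ℝ] TangentSpace 𝓘(ℝ, E) (g * φ t)) =
      (mfderiv 𝓘(ℝ, E) 𝓘(ℝ, E) (g * ·) (φ t)).comp (ContinuousLinearMap.smulRight
        (1 : ℝ →L[ℝ] ℝ) (mulInvariantVectorField X (φ t))) := by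
    rw [h3]
    ext
    simp
  exact (congrArg (fun T => HasMFDerivAt 𝓘(ℝ, ℝ) 𝓘(ℝ, E) (fun t => g * φ t) t T) h5).mpr h2

variable [T2Space G]

/-- Running the integral curve of X at speed t gives an integral curve of tX. -/
theorem expMap_smul_eq (X : E) (φ : ℝ → G)
    (h : IsMIntegralCurve (I := 𝓘(ℝ, E)) φ
      (mulInvariantVectorField (I := 𝓘(ℝ, E)) (G := G) X)) (h0 : φ 0 = 1) (t : ℝ) :
    expMap (t • X) = φ t := by
  have h1 := h.comp_mul t
  have := lieExp_eq (E := E) (G := G) (t • X : E) (φ ∘ fun s => s * t)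
    (by
      have h2 := mulInvariantVectorField_smul (I := 𝓘(ℝ, E)) (G := G) t X
      exact h2 ▸ h1) (by simpa using h0)
  simpa [expMap] using this

theorem isMIntegralCurve_expMap (X : E) : IsMIntegralCurve (I := 𝓘(ℝ, E))
    (fun t : ℝ => expMap (G := G) (t • X))
      (mulInvariantVectorField (I := 𝓘(ℝ, E)) (G := G) X) := by
  obtain ⟨φ, h, h0⟩ := exists_oneParameterCurve (E := E) (G := G) X
  rwa [show (fun t : ℝ => expMap (t • X)) = φ from funext fun t => expMap_smul_eq X φ h h0 t]

theorem expMap_zero : expMap (0 : E) = (1 : G) := by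
  obtain ⟨φ, h, h0⟩ := exists_oneParameterCurve (E := E) (G := G) (0 : E)
  simpa [h0] using expMap_smul_eq 0 φ h h0 0

/-- As functions of t, both sides are integral curves of the same left-invariant field with the same
value at t = 0, so uniqueness applies. -/
theorem expMap_add_smul (X : E) (s t : ℝ) :
    expMap (G := G) ((s + t) • X) = expMap (s • X) * expMap (t • X) := by
  have h := isMIntegralCurve_expMap (G := G) X
  have h1 := IsMIntegralCurve.mul_left h (expMap (s • X))
  have h2 := h.comp_add s
  have := isMIntegralCurve_Ioo_eq_of_contMDiff_boundaryless (t₀ := 0)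
    (contMDiff_leftInvariant (E := E) (G := G) X) h1 h2 (by simp [expMap_zero])
  have := congrFun this t
  simp only [Function.comp] at this
  rw [this, add_comm]

end Exp

/-! ### The Lie bracket and the velocity of exp, read in the chart -/

section ExpDeriv

variable {E : Type*} [NormedAddCommGroup E] [NormedSpace ℝ E]
  {G : Type*} [TopologicalSpace G] [ChartedSpace E G] [Group G] [LieGroup 𝓘(ℝ, E) ∞ G]

theorem mfderiv_extChartAt_mulInvariantVectorField_of_eq_one (X : GroupLieAlgebra 𝓘(ℝ, E) G)
    {g : G} (hg : g = 1) :
    (mfderiv 𝓘(ℝ, E) 𝓘(ℝ, E) (extChartAt 𝓘(ℝ, E) (1 : G)) g (mulInvariantVectorField X g) : E) =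
      X := by
  subst hg
  have : IsManifold 𝓘(ℝ, E) 1 G := IsManifold.of_le (n := ∞) (ENat.LEInfty.out)
  rw [mfderiv_extChartAt_self]
  have h : ((1 : G) * · : G → G) = id := by ext; simp
  simp only [mulInvariantVectorField]
  rw [h, mfderiv_id]
  rfl

theorem hasDerivAt_idChart_expMap [CompleteSpace E] [T2Space G] (X : E) :
    HasDerivAt (fun t : ℝ => idChart E G (expMap (t • X))) X 0 := by
  have h0 : expMap (G := G) ((0 : ℝ) • X) = 1 := by rw [zero_smul, expMap_zero]
  have h := isMIntegralCurve_expMap (G := G) X 0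
  have hφ : HasMFDerivAt 𝓘(ℝ, E) 𝓘(ℝ, E) (extChartAt 𝓘(ℝ, E) (1 : G))
      (expMap (G := G) ((0 : ℝ) • X))
      (mfderiv 𝓘(ℝ, E) 𝓘(ℝ, E) (extChartAt 𝓘(ℝ, E) (1 : G)) (expMap (G := G) ((0 : ℝ) • X))) := by
    have : IsManifold 𝓘(ℝ, E) 1 G := IsManifold.of_le (n := ∞) (ENat.LEInfty.out)
    apply MDifferentiableAt.hasMFDerivAt
    rw [h0]
    exact mdifferentiableAt_extChartAt (mem_chart_source E (1 : G))
  obtain ⟨L, hL, hL1⟩ : ∃ L : ℝ →L[ℝ] E,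
      HasFDerivAt (fun t : ℝ => extChartAt 𝓘(ℝ, E) (1 : G) (expMap (t • X))) L 0 ∧ L 1 = X := by
    refine ⟨_, hasMFDerivAt_iff_hasFDerivAt.1 (hφ.comp (0 : ℝ) h), ?_⟩
    refine Eq.trans ?_ (mfderiv_extChartAt_mulInvariantVectorField_of_eq_one (G := G) X h0)
    change (mfderiv 𝓘(ℝ, E) 𝓘(ℝ, E) (extChartAt 𝓘(ℝ, E) (1 : G)) (expMap (G := G) ((0 : ℝ) • X)))
      ((1 : ℝ) • _) = _
    rw [one_smul]
  have h2 : HasDerivAt (fun t : ℝ => extChartAt 𝓘(ℝ, E) (1 : G) (expMap (t • X))) X 0 :=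
    hL1 ▸ hL.hasDerivAt
  simp only [idChart_apply]
  exact h2.sub_const _

/-- The coordinate expression of a left-invariant vector field; this is the chain rule for the chart
composed with left multiplication. -/
theorem leftDeriv_idChart (x : E) (hx : x ∈ (extChartAt 𝓘(ℝ, E) (1 : G)).target) (X : E) :
    leftDeriv (idChart E G) (x - extChartAt 𝓘(ℝ, E) (1 : G) 1) X =
      mfderiv 𝓘(ℝ, E) 𝓘(ℝ, E) (extChartAt 𝓘(ℝ, E) (1 : G))
        ((extChartAt 𝓘(ℝ, E) (1 : G)).symm x)
        (mulInvariantVectorField (I := 𝓘(ℝ, E)) (G := G) X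
          ((extChartAt 𝓘(ℝ, E) (1 : G)).symm x)) := by
  have : IsManifold 𝓘(ℝ, E) 1 G := IsManifold.of_le (n := ∞) (ENat.LEInfty.out)
  set φ := extChartAt 𝓘(ℝ, E) (1 : G) with hφ
  set g := φ.symm x with hg
  have hgs : g ∈ (chartAt E (1 : G)).source := by
    have := φ.map_target hx
    rwa [hφ, extChartAt_source] at this
  have h1 : HasMFDerivAt 𝓘(ℝ, E) 𝓘(ℝ, E) φ g (mfderiv 𝓘(ℝ, E) 𝓘(ℝ, E) φ g) :=
    (mdifferentiableAt_extChartAt hgs).hasMFDerivAt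
  have h2 : HasMFDerivAt 𝓘(ℝ, E) 𝓘(ℝ, E) (g * ·) (1 : G)
      (mfderiv 𝓘(ℝ, E) 𝓘(ℝ, E) (g * ·) (1 : G)) :=
    ((contMDiff_mul_left (I := 𝓘(ℝ, E)) (n := ∞)).mdifferentiableAt (by simp)).hasMFDerivAt
  have h5 : HasMFDerivAt 𝓘(ℝ, E) 𝓘(ℝ, E) (φ ∘ (g * ·)) (1 : G)
      ((mfderiv 𝓘(ℝ, E) 𝓘(ℝ, E) φ g).comp (mfderiv 𝓘(ℝ, E) 𝓘(ℝ, E) (g * ·) (1 : G))) := by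
    refine HasMFDerivAt.comp (1 : G) ?_ h2
    exact (mul_one g).symm ▸ h1
  let T : E →L[ℝ] E :=
    (mfderiv 𝓘(ℝ, E) 𝓘(ℝ, E) φ g).comp (mfderiv 𝓘(ℝ, E) 𝓘(ℝ, E) (g * ·) (1 : G))
  have h6 : HasFDerivAt (fun y => φ (g * φ.symm y)) T (φ 1) := by
    have h7 : HasFDerivWithinAt (fun y => φ (g * φ.symm y)) T (range (id : E → E)) (φ 1) := h5.2
    rwa [range_id, hasFDerivWithinAt_univ] at h7
  have h8 : HasFDerivAt (fun y : E => y + φ 1) (ContinuousLinearMap.id ℝ E) 0 :=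
    (hasFDerivAt_id (0 : E)).add_const _
  have h9 := ((zero_add (φ 1)).symm ▸ h6).comp (0 : E) h8
  have h10 := (h9.sub_const (φ 1)).fderiv
  have h11 : leftDeriv (idChart E G) (x - φ 1) = fderiv ℝ (fun y => φ (g * φ.symm (y + φ 1)) - φ 1) 0 := by
    simp only [leftDeriv, idChart_symm_apply, idChart_apply, ← hφ, sub_add_cancel, ← hg]
  rw [h11]
  exact congrArg (fun T : E →L[ℝ] E => T X) h10

theorem inverse_mfderiv_extChartAt_one_apply (v : GroupLieAlgebra 𝓘(ℝ, E) G) :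
    (mfderiv 𝓘(ℝ, E) 𝓘(ℝ, E) (extChartAt 𝓘(ℝ, E) (1 : G)) 1).inverse v = v := by
  have : IsManifold 𝓘(ℝ, E) 1 G := IsManifold.of_le (n := ∞) (ENat.LEInfty.out)
  rw [mfderiv_extChartAt_self]
  exact congrArg (fun T => T v) (ContinuousLinearMap.inverse_id (R := ℝ) (M := E))

theorem inverse_mfderivWithin_extChartAt_symm {x : E}
    (hx : x ∈ (extChartAt 𝓘(ℝ, E) (1 : G)).target) :
    (mfderivWithin 𝓘(ℝ, E) 𝓘(ℝ, E) (extChartAt 𝓘(ℝ, E) (1 : G)).symm (range 𝓘(ℝ, E)) x).inverse =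
      mfderiv 𝓘(ℝ, E) 𝓘(ℝ, E) (extChartAt 𝓘(ℝ, E) (1 : G))
        ((extChartAt 𝓘(ℝ, E) (1 : G)).symm x) := by
  have : IsManifold 𝓘(ℝ, E) 1 G := IsManifold.of_le (n := ∞) (ENat.LEInfty.out)
  exact ContinuousLinearMap.inverse_eq (mfderivWithin_extChartAt_symm_comp_mfderiv_extChartAt hx)
    (mfderiv_extChartAt_comp_mfderivWithin_extChartAt_symm hx)

/-- In coordinates the bracket of two vector fields is DY·X - DX·Y. For the left-invariant fields x
↦ `leftDeriv` x Z, with `leftDeriv` equal to the identity at 0, this is the antisymmetrized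
derivative of `leftDeriv` at 0. -/
theorem bracket_eq_chartBracket [CompleteSpace E]
    (hd : DifferentiableAt ℝ (leftDeriv (idChart E G)) 0) (X Y : GroupLieAlgebra 𝓘(ℝ, E) G) :
    ⁅X, Y⁆ = chartBracket (idChart E G) X Y := by
  set φ := extChartAt 𝓘(ℝ, E) (1 : G) with hφ
  have key : ∀ Z : GroupLieAlgebra 𝓘(ℝ, E) G,
      VectorField.mpullbackWithin 𝓘(ℝ, E) 𝓘(ℝ, E) φ.symm (mulInvariantVectorField Z)
        (range 𝓘(ℝ, E)) =ᶠ[𝓝 (φ 1)] fun x => leftDeriv (idChart E G) (x - φ 1) Z := by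
    intro Z
    filter_upwards [extChartAt_target_mem_nhds (I := 𝓘(ℝ, E)) (1 : G)] with x hx
    refine Eq.trans ?_ (leftDeriv_idChart x hx Z).symm
    rw [VectorField.mpullbackWithin_apply, inverse_mfderivWithin_extChartAt_symm hx]
    rfl
  let VX : E → E := VectorField.mpullbackWithin 𝓘(ℝ, E) 𝓘(ℝ, E) φ.symm
    (mulInvariantVectorField X) (range 𝓘(ℝ, E))
  let VY : E → E := VectorField.mpullbackWithin 𝓘(ℝ, E) 𝓘(ℝ, E) φ.symm
    (mulInvariantVectorField Y) (range 𝓘(ℝ, E))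
  let B : E := VectorField.lieBracketWithin ℝ VX VY (φ.symm ⁻¹' univ ∩ range (id : E → E)) (φ 1)
  have h0 : ⁅X, Y⁆ = (mfderiv 𝓘(ℝ, E) 𝓘(ℝ, E) φ 1).inverse B := rfl
  refine (h0.trans (inverse_mfderiv_extChartAt_one_apply _)).trans ?_
  simp only [B]
  rw [preimage_univ, univ_inter, range_id, VectorField.lieBracketWithin_univ]
  have kX : VX =ᶠ[𝓝 (φ 1)] fun x => leftDeriv (idChart E G) (x - φ 1) X := key X
  have kY : VY =ᶠ[𝓝 (φ 1)] fun x => leftDeriv (idChart E G) (x - φ 1) Y := key Y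
  refine (kX.lieBracket_vectorField_eq kY).trans ?_
  rw [VectorField.lieBracket_eq]
  have hone : leftDeriv (idChart E G) 0 = ContinuousLinearMap.id ℝ E := by
    have h1 : (fun y => idChart E G ((idChart E G).symm 0 * (idChart E G).symm y)) =ᶠ[𝓝 0] id := by
      filter_upwards [(idChart E G).open_target.mem_nhds
        (idChart_one (E := E) (G := G) ▸ (idChart E G).map_source one_mem_idChart_source)] with y hy
      rw [idChart_symm_zero, one_mul, (idChart E G).right_inv hy, id]
    rw [leftDeriv, h1.fderiv_eq, fderiv_id]
  have hder : ∀ Z : E, HasFDerivAt (fun x => leftDeriv (idChart E G) (x - φ 1) Z)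
      ((fderiv ℝ (leftDeriv (idChart E G)) 0).flip Z) (φ 1) := by
    intro Z
    have h1 : HasFDerivAt (fun x : E => x - φ 1) (ContinuousLinearMap.id ℝ E) (φ 1) :=
      (hasFDerivAt_id _).sub_const _
    have h2 := HasFDerivAt.comp (φ 1) (by rw [sub_self]; exact hd.hasFDerivAt) h1
    have h3 := h2.clm_apply (hasFDerivAt_const Z (φ 1))
    refine h3.congr_fderiv ?_
    ext w
    simp
  -- X and Y are retyped as vectors of the model space, so that the coordinate formula can be stated
  -- there.
  obtain ⟨X', hX⟩ : ∃ X' : E, X' = X := ⟨X, rfl⟩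
  obtain ⟨Y', hY⟩ : ∃ Y' : E, Y' = Y := ⟨Y, rfl⟩
  subst hX hY
  change (fderiv ℝ (fun x => leftDeriv (idChart E G) (x - φ 1) Y') (φ 1))
      (leftDeriv (idChart E G) (φ 1 - φ 1) X') -
    (fderiv ℝ (fun x => leftDeriv (idChart E G) (x - φ 1) X') (φ 1))
      (leftDeriv (idChart E G) (φ 1 - φ 1) Y') =
    fderiv ℝ (leftDeriv (idChart E G)) 0 X' Y' - fderiv ℝ (leftDeriv (idChart E G)) 0 Y' X'
  rw [(hder X').fderiv, (hder Y').fderiv, sub_self, hone]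
  rfl

end ExpDeriv

/-! ### The adjoint representation and its derivative -/

section Adjoint

variable {E G : Type*} [NormedAddCommGroup E] [NormedSpace ℝ E] [TopologicalSpace G] [Group G]
  {κ : OpenPartialHomeomorph G E}

/-- Group multiplication read in a chart. -/
def chartMul (κ : OpenPartialHomeomorph G E) (p : E × E) : E := κ (κ.symm p.1 * κ.symm p.2)

namespace IsIdentityChart

variable (hκ : IsIdentityChart κ)
include hκ

theorem zero_mem : (0 : E) ∈ κ.target := hκ.map_one ▸ κ.map_source hκ.one_mem

theorem symm_zero : κ.symm 0 = 1 := by rw [← hκ.map_one, κ.left_inv hκ.one_mem]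

theorem target_mem : κ.target ∈ 𝓝 (0 : E) := κ.open_target.mem_nhds hκ.zero_mem

theorem source_mem : κ.source ∈ 𝓝 (1 : G) := κ.open_source.mem_nhds hκ.one_mem

theorem continuousAt_symm : ContinuousAt κ.symm 0 := κ.symm.continuousAt hκ.zero_mem

theorem continuousAt_one : ContinuousAt κ 1 := κ.continuousAt hκ.one_mem

theorem tendsto_one : Tendsto κ (𝓝 1) (𝓝 0) := by
  simpa [ContinuousAt, hκ.map_one] using hκ.continuousAt_one

theorem tendsto_symm : Tendsto κ.symm (𝓝 0) (𝓝 1) := by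
  simpa [ContinuousAt, hκ.symm_zero] using hκ.continuousAt_symm

theorem chartMul_zero_left : ∀ᶠ y in 𝓝 (0 : E), chartMul κ (0, y) = y := by
  filter_upwards [hκ.target_mem] with y hy
  simp [chartMul, hκ.symm_zero, κ.right_inv hy]

theorem chartMul_zero_right : ∀ᶠ x in 𝓝 (0 : E), chartMul κ (x, 0) = x := by
  filter_upwards [hκ.target_mem] with y hy
  simp [chartMul, hκ.symm_zero, κ.right_inv hy]

theorem eventually_differentiableAt_chartMul :
    ∀ᶠ p in 𝓝 ((0, 0) : E × E), DifferentiableAt ℝ (chartMul κ) p := by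
  filter_upwards [hκ.contDiffAt_mul.eventually (by simp)] with p hp
  exact hp.differentiableAt (by simp)

theorem contDiffAt_fderiv_chartMul : ContDiffAt ℝ 1 (fderiv ℝ (chartMul κ)) (0, 0) :=
  hκ.contDiffAt_mul.fderiv_right (by norm_num)

theorem eventually_hasFDerivAt_left : ∀ᶠ x in 𝓝 (0 : E),
    HasFDerivAt (fun y => κ (κ.symm x * κ.symm y))
      ((fderiv ℝ (chartMul κ) (x, 0)).comp (ContinuousLinearMap.inr ℝ E E)) 0 := by
  have hc : Tendsto (fun x : E => (x, (0 : E))) (𝓝 0) (𝓝 (0, 0)) :=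
    (Continuous.prodMk_left (0 : E)).tendsto 0
  filter_upwards [hc.eventually hκ.eventually_differentiableAt_chartMul] with x hx
  exact HasFDerivAt.comp (f := fun y : E => (x, y)) (0 : E) hx.hasFDerivAt
    (hasFDerivAt_prodMk_right x 0)

theorem eventually_hasFDerivAt_right : ∀ᶠ x in 𝓝 (0 : E),
    HasFDerivAt (fun y => κ (κ.symm y * κ.symm x))
      ((fderiv ℝ (chartMul κ) (0, x)).comp (ContinuousLinearMap.inl ℝ E E)) 0 := by
  have hc : Tendsto (fun x : E => ((0 : E), x)) (𝓝 0) (𝓝 (0, 0)) :=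
    (Continuous.prodMk_right (0 : E)).tendsto 0
  filter_upwards [hc.eventually hκ.eventually_differentiableAt_chartMul] with x hx
  exact HasFDerivAt.comp (f := fun y : E => (y, x)) (0 : E) hx.hasFDerivAt
    (hasFDerivAt_prodMk_left 0 x)

theorem leftDeriv_eventuallyEq : leftDeriv κ =ᶠ[𝓝 0] fun x =>
    (fderiv ℝ (chartMul κ) (x, 0)).comp (ContinuousLinearMap.inr ℝ E E) := by
  filter_upwards [hκ.eventually_hasFDerivAt_left] with x hx using hx.fderiv

theorem rightDeriv_eventuallyEq : rightDeriv κ =ᶠ[𝓝 0] fun x =>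
    (fderiv ℝ (chartMul κ) (0, x)).comp (ContinuousLinearMap.inl ℝ E E) := by
  filter_upwards [hκ.eventually_hasFDerivAt_right] with x hx using hx.fderiv

theorem leftDeriv_zero : leftDeriv κ 0 = ContinuousLinearMap.id ℝ E := by
  have h : (fun y => κ (κ.symm 0 * κ.symm y)) =ᶠ[𝓝 0] id := hκ.chartMul_zero_left
  rw [leftDeriv, h.fderiv_eq, fderiv_id]

theorem rightDeriv_zero : rightDeriv κ 0 = ContinuousLinearMap.id ℝ E := by
  have h : (fun y => κ (κ.symm y * κ.symm 0)) =ᶠ[𝓝 0] id := hκ.chartMul_zero_right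
  rw [rightDeriv, h.fderiv_eq, fderiv_id]

theorem hasFDerivAt_fderiv_chartMul : HasFDerivAt (fderiv ℝ (chartMul κ))
    (fderiv ℝ (fderiv ℝ (chartMul κ)) (0, 0)) (0, 0) :=
  (hκ.contDiffAt_fderiv_chartMul.differentiableAt (by simp)).hasFDerivAt

theorem hasFDerivAt_leftDeriv : HasFDerivAt (leftDeriv κ) (fderiv ℝ (leftDeriv κ) 0) 0 := by
  have h1 := HasFDerivAt.comp (f := fun x : E => (x, (0 : E))) (0 : E)
    hκ.hasFDerivAt_fderiv_chartMul (hasFDerivAt_prodMk_left 0 0)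
  have h2 := h1.clm_comp (hasFDerivAt_const (ContinuousLinearMap.inr ℝ E E) (0 : E))
  exact (h2.congr_of_eventuallyEq hκ.leftDeriv_eventuallyEq).differentiableAt.hasFDerivAt

theorem fderiv_leftDeriv_apply (u v : E) : fderiv ℝ (leftDeriv κ) 0 u v =
    fderiv ℝ (fderiv ℝ (chartMul κ)) (0, 0) (u, 0) (0, v) := by
  have h1 := HasFDerivAt.comp (f := fun x : E => (x, (0 : E))) (0 : E)
    hκ.hasFDerivAt_fderiv_chartMul (hasFDerivAt_prodMk_left 0 0)
  have h2 := h1.clm_comp (hasFDerivAt_const (ContinuousLinearMap.inr ℝ E E) (0 : E))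
  rw [(h2.congr_of_eventuallyEq hκ.leftDeriv_eventuallyEq).fderiv]
  simp

/-- Both one-sided derivatives are partial derivatives of the same C² product, so symmetry of its
second derivative at the origin exchanges the two arguments. -/
theorem hasFDerivAt_rightDeriv :
    HasFDerivAt (rightDeriv κ) (fderiv ℝ (leftDeriv κ) 0).flip 0 := by
  have h1 := HasFDerivAt.comp (f := fun x : E => ((0 : E), x)) (0 : E)
    hκ.hasFDerivAt_fderiv_chartMul (hasFDerivAt_prodMk_right 0 0)
  have h2 := h1.clm_comp (hasFDerivAt_const (ContinuousLinearMap.inl ℝ E E) (0 : E))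
  refine (h2.congr_of_eventuallyEq hκ.rightDeriv_eventuallyEq).congr_fderiv ?_
  have hs : IsSymmSndFDerivAt ℝ (chartMul κ) ((0, 0) : E × E) :=
    hκ.contDiffAt_mul.isSymmSndFDerivAt (by simp)
  ext u v
  have := hs (0, u) (v, 0)
  simpa [hκ.fderiv_leftDeriv_apply] using this

theorem hasStrictFDerivAt_chartMul : HasStrictFDerivAt (chartMul κ)
    (ContinuousLinearMap.fst ℝ E E + ContinuousLinearMap.snd ℝ E E) (0, 0) := by
  have h : HasStrictFDerivAt (chartMul κ) (fderiv ℝ (chartMul κ) (0, 0)) (0, 0) :=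
    hκ.contDiffAt_mul.hasStrictFDerivAt (by simp)
  have e1 : (fderiv ℝ (chartMul κ) (0, 0)).comp (ContinuousLinearMap.inr ℝ E E) = .id ℝ E := by
    exact hκ.leftDeriv_eventuallyEq.self_of_nhds.symm.trans hκ.leftDeriv_zero
  have e2 : (fderiv ℝ (chartMul κ) (0, 0)).comp (ContinuousLinearMap.inl ℝ E E) = .id ℝ E := by
    exact hκ.rightDeriv_eventuallyEq.self_of_nhds.symm.trans hκ.rightDeriv_zero
  refine h.congr_fderiv ?_
  ext v
  · simpa using congrArg (fun T => T v) e2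
  · simpa using congrArg (fun T => T v) e1

end IsIdentityChart

/-- The adjoint representation in a chart: the derivative of conjugation at the identity. -/
noncomputable def chartAd (κ : OpenPartialHomeomorph G E) (g : G) : E →L[ℝ] E :=
  fderiv ℝ (fun x => κ (g * κ.symm x * g⁻¹)) 0

namespace IsIdentityChart

variable (hκ : IsIdentityChart κ)
include hκ

theorem hasFDerivAt_conj (g : G) :
    HasFDerivAt (fun x => κ (g * κ.symm x * g⁻¹)) (chartAd κ g) 0 :=
  ((hκ.contDiffAt_conj g).differentiableAt (by simp)).hasFDerivAt

theorem conj_zero (g : G) : κ (g * κ.symm 0 * g⁻¹) = 0 := by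
  simp [hκ.symm_zero, hκ.map_one]

theorem chartAd_one : chartAd κ (1 : G) = .id ℝ E := by
  have h : (fun x => κ ((1 : G) * κ.symm x * (1 : G)⁻¹)) =ᶠ[𝓝 0] id := by
    filter_upwards [hκ.target_mem] with x hx
    simp [κ.right_inv hx]
  rw [chartAd, h.fderiv_eq, fderiv_id]

variable [IsTopologicalGroup G]

theorem tendsto_conj_symm (g : G) : Tendsto (fun x => g * κ.symm x * g⁻¹) (𝓝 0) (𝓝 1) := by
  have h := (hκ.tendsto_symm.const_mul g).mul_const g⁻¹
  simpa using h

theorem chartAd_mul (g h : G) : chartAd κ (g * h) = (chartAd κ g).comp (chartAd κ h) := by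
  have h1 := HasFDerivAt.comp (0 : E) (by rw [hκ.conj_zero]; exact hκ.hasFDerivAt_conj g)
    (hκ.hasFDerivAt_conj h)
  have h2 : (fun x => κ (g * h * κ.symm x * (g * h)⁻¹)) =ᶠ[𝓝 0]
      (fun x => κ (g * κ.symm x * g⁻¹)) ∘ (fun x => κ (h * κ.symm x * h⁻¹)) := by
    filter_upwards [(hκ.tendsto_conj_symm h).eventually hκ.source_mem] with x hx
    simp only [Function.comp, κ.left_inv hx]
    group
  exact (h1.congr_of_eventuallyEq h2).fderiv

/-- Differentiate g·y = (g y g⁻¹)·g at y = 1. -/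
theorem leftDeriv_eq_rightDeriv_comp_chartAd :
    ∀ᶠ g in 𝓝 (1 : G), leftDeriv κ (κ g) = (rightDeriv κ (κ g)).comp (chartAd κ g) := by
  filter_upwards [hκ.source_mem, hκ.tendsto_one.eventually hκ.eventually_hasFDerivAt_right,
    hκ.tendsto_one.eventually hκ.rightDeriv_eventuallyEq] with g hg hr hr'
  rw [← hr'] at hr
  have h1 := HasFDerivAt.comp (0 : E) (by rw [hκ.conj_zero]; exact hr) (hκ.hasFDerivAt_conj g)
  refine (h1.congr_of_eventuallyEq ?_).fderiv
  filter_upwards [(hκ.tendsto_conj_symm g).eventually hκ.source_mem] with x hx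
  simp only [Function.comp, κ.left_inv hx, κ.left_inv hg]
  group

/-- Near the identity Ad = R⁻¹L, with L and R the derivatives of left and right translations. Since
L = R = 1 at the identity, the derivative is L' - R', which is the bracket with X. -/
theorem hasDerivAt_chartAd [CompleteSpace E] {g : ℝ → G} {X : E} (h0 : g 0 = 1)
    (hc : ContinuousAt g 0) (hd : HasDerivAt (fun t => κ (g t)) X 0) :
    HasDerivAt (fun t => chartAd κ (g t)) (chartBracket κ X) 0 := by
  have hκ0 : κ (g 0) = 0 := by rw [h0, hκ.map_one]
  have hl : HasDerivAt (fun t => leftDeriv κ (κ (g t))) (fderiv ℝ (leftDeriv κ) 0 X) 0 :=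
    hκ.hasFDerivAt_leftDeriv.comp_hasDerivAt_of_eq (0 : ℝ) hd hκ0.symm
  have hr : HasDerivAt (fun t => rightDeriv κ (κ (g t))) ((fderiv ℝ (leftDeriv κ) 0).flip X) 0 :=
    hκ.hasFDerivAt_rightDeriv.comp_hasDerivAt_of_eq (0 : ℝ) hd hκ0.symm
  have hr0 : rightDeriv κ (κ (g 0)) = ((1 : (E →L[ℝ] E)ˣ) : E →L[ℝ] E) := by
    rw [hκ0, hκ.rightDeriv_zero]; rfl
  have hinv := HasFDerivAt.comp_hasDerivAt (0 : ℝ)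
    (by rw [hr0]; exact hasFDerivAt_ringInverse (𝕜 := ℝ) (1 : (E →L[ℝ] E)ˣ)) hr
  have hprod := hinv.mul hl
  have hcg : Tendsto g (𝓝 0) (𝓝 1) := by simpa [ContinuousAt, h0] using hc
  have hunit : ∀ᶠ t in 𝓝 (0 : ℝ), IsUnit (rightDeriv κ (κ (g t))) := by
    refine hr.continuousAt.eventually (p := IsUnit) ?_
    simp only [hr0]
    exact Units.isOpen.mem_nhds (Units.isUnit _)
  have he : (fun t => chartAd κ (g t)) =ᶠ[𝓝 0]
      (Ring.inverse ∘ fun t => rightDeriv κ (κ (g t))) * (fun t => leftDeriv κ (κ (g t))) := by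
    filter_upwards [hcg.eventually hκ.leftDeriv_eq_rightDeriv_comp_chartAd, hunit] with t ht hu
    simp only [Pi.mul_apply, Function.comp, ht]
    exact (Ring.inverse_mul_cancel_left _ _ hu).symm
  refine (hprod.congr_of_eventuallyEq he).congr_deriv ?_
  rw [Function.comp, hr0, Ring.inverse_unit, hκ0, hκ.leftDeriv_zero]
  ext v
  simp [chartBracket, sub_eq_neg_add]

end IsIdentityChart

end Adjoint

/-! ### Exponential series of a nilpotent element -/

section NilpotentSeries

variable {R : Type*} [NormedRing R] [NormedAlgebra ℝ R]

/-- The truncated series of `exp (-s A)`. -/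
noncomputable def negExpSum (n : ℕ) (A : R) (s : ℝ) : R :=
  ∑ k ∈ Finset.range n, ((-s) ^ k / (k.factorial : ℝ)) • A ^ k

/-- The truncated series of the primitive `(1 - exp (-s A)) / A` of `exp (-s A)`. -/
noncomputable def negExpPrimitive (n : ℕ) (A : R) (s : ℝ) : R :=
  ∑ k ∈ Finset.range n, ((-1) ^ k * s ^ (k + 1) / ((k + 1).factorial : ℝ)) • A ^ k

theorem hasDerivAt_negExpPrimitive (n : ℕ) (A : R) (s : ℝ) :
    HasDerivAt (negExpPrimitive n A) (negExpSum n A s) s := by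
  refine HasDerivAt.fun_sum fun k _ => HasDerivAt.smul_const ?_ _
  have h := ((hasDerivAt_pow (k + 1) s).const_mul ((-1 : ℝ) ^ k)).div_const ((k + 1).factorial : ℝ)
  refine h.congr_deriv ?_
  rw [Nat.factorial_succ, neg_pow s k]
  push_cast
  field_simp

/-- Differentiation shifts the truncated series by one index; the missing top term contains A^n,
which is zero. -/
theorem hasDerivAt_negExpSum {n : ℕ} {A : R} (hA : A ^ n = 0) (s : ℝ) :
    HasDerivAt (negExpSum n A) (-(A * negExpSum n A s)) s := by
  have h1 : HasDerivAt (negExpSum n A)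
      (∑ k ∈ Finset.range n, ((k : ℝ) * (-s) ^ (k - 1) * (-1) / (k.factorial : ℝ)) • A ^ k) s := by
    refine HasDerivAt.fun_sum fun k _ => HasDerivAt.smul_const ?_ _
    exact ((hasDerivAt_id s).neg.pow k).div_const _
  refine h1.congr_deriv ?_
  cases n with
  | zero => simp [negExpSum]
  | succ m =>
    rw [Finset.sum_range_succ', negExpSum, Finset.sum_range_succ, mul_add, mul_smul_comm,
      ← pow_succ', hA, smul_zero, add_zero, Finset.mul_sum, ← Finset.sum_neg_distrib]
    simp only [Nat.cast_zero, zero_mul, zero_div, zero_smul, add_zero]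
    refine Finset.sum_congr rfl fun k _ => ?_
    rw [mul_smul_comm, ← pow_succ', ← neg_smul, Nat.factorial_succ]
    congr 1
    push_cast
    field_simp

theorem negExpSum_zero {n : ℕ} {A : R} (hA : A ^ n = 0) : negExpSum n A 0 = 1 := by
  cases n with
  | zero => simpa [negExpSum] using hA.symm
  | succ m => rw [negExpSum, Finset.sum_range_succ']; simp

theorem negExpPrimitive_zero (n : ℕ) (A : R) : negExpPrimitive n A 0 = 0 := by
  simp [negExpPrimitive]

theorem continuous_negExpSum (n : ℕ) :
    Continuous fun p : R × ℝ => negExpSum n p.1 p.2 := by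
  unfold negExpSum
  fun_prop

theorem continuous_negExpPrimitive (n : ℕ) (s : ℝ) :
    Continuous fun A : R => negExpPrimitive n A s := by
  unfold negExpPrimitive
  fun_prop

theorem eq_negExpSum_of_hasDerivAt {n : ℕ} {A : R} (hA : A ^ n = 0) {f : ℝ → R}
    (hf : ∀ s, HasDerivAt f (-(A * f s)) s) (h0 : f 0 = 1) : f = negExpSum n A := by
  refine ODE_solution_unique_univ (v := fun _ x => -(A * x)) (s := fun _ => univ) (t₀ := 0)
    (K := ⟨‖A‖, norm_nonneg A⟩) (fun t => ?_) (fun t => ⟨hf t, mem_univ _⟩)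
    (fun t => ⟨hasDerivAt_negExpSum hA t, mem_univ _⟩) (by rw [h0, negExpSum_zero hA])
  refine LipschitzWith.lipschitzOnWith (LipschitzWith.of_dist_le_mul fun x y => ?_)
  rw [dist_neg_neg, dist_eq_norm, ← mul_sub, dist_eq_norm]
  exact norm_mul_le _ _

end NilpotentSeries

/-! ### Left logarithmic derivatives of curves -/

variable {E G : Type*} [NormedAddCommGroup E] [NormedSpace ℝ E] [TopologicalSpace G] [Group G]
  {κ : OpenPartialHomeomorph G E}

/-- The characteristic properties of the exponential map of a group, in a chart at the identity. -/
structure IsExponential (κ : OpenPartialHomeomorph G E) (e : E → G) : Prop where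
  add_smul : ∀ (X : E) (s t : ℝ), e ((s + t) • X) = e (s • X) * e (t • X)
  hasDerivAt : ∀ X : E, HasDerivAt (fun t : ℝ => κ (e (t • X))) X 0
  continuousAt : ∀ X : E, ContinuousAt (fun t : ℝ => e (t • X)) 0

namespace IsExponential

variable {e : E → G} (he : IsExponential κ e)
include he

theorem map_zero : e 0 = 1 := by
  have h := he.add_smul 0 0 0
  simpa using h

theorem map_neg (X : E) : e (-X) = (e X)⁻¹ := by
  have h := he.add_smul X 1 (-1)
  rw [add_neg_cancel, zero_smul, he.map_zero, one_smul, neg_smul, one_smul] at h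
  exact (inv_eq_of_mul_eq_one_right h.symm).symm

theorem inv_mul_smul (X : E) (s t : ℝ) : (e (s • X))⁻¹ * e (t • X) = e ((t - s) • X) := by
  rw [inv_mul_eq_iff_eq_mul, ← he.add_smul, add_sub_cancel]

end IsExponential

/-- The curve `c` has left logarithmic derivative `w` at `s`. -/
def HasLogDeriv (κ : OpenPartialHomeomorph G E) (c : ℝ → G) (w : E) (s : ℝ) : Prop :=
  ContinuousAt c s ∧ HasDerivAt (fun t => κ ((c s)⁻¹ * c t)) w s

variable [IsTopologicalGroup G]

theorem HasLogDeriv.tendsto {c : ℝ → G} {w : E} {s : ℝ} (hc : HasLogDeriv κ c w s) :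
    Tendsto (fun t => (c s)⁻¹ * c t) (𝓝 s) (𝓝 1) := by
  have h := hc.1.tendsto.const_mul (c s)⁻¹
  simpa using h

theorem HasLogDeriv.mul (hκ : IsIdentityChart κ) {c d : ℝ → G} {u v : E} {s : ℝ}
    (hc : HasLogDeriv κ c u s) (hd : HasLogDeriv κ d v s) :
    HasLogDeriv κ (fun t => c t * d t) (chartAd κ (d s)⁻¹ u + v) s := by
  refine ⟨hc.1.mul hd.1, ?_⟩
  have h1 : HasDerivAt (fun t => κ ((d s)⁻¹ * κ.symm (κ ((c s)⁻¹ * c t)) * (d s)⁻¹⁻¹))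
      (chartAd κ (d s)⁻¹ u) s :=
    (hκ.hasFDerivAt_conj (d s)⁻¹).comp_hasDerivAt_of_eq s hc.2 (by simp [hκ.map_one])
  have h2 := hκ.hasStrictFDerivAt_chartMul.hasFDerivAt.comp_hasDerivAt_of_eq s (h1.prodMk hd.2)
    (by simp [hκ.map_one, hκ.symm_zero])
  refine (h2.congr_of_eventuallyEq ?_).congr_deriv (by simp)
  have h3 : Tendsto (fun t => (d s)⁻¹ * ((c s)⁻¹ * c t) * (d s)⁻¹⁻¹) (𝓝 s) (𝓝 1) := by
    have h := (hc.tendsto.const_mul (d s)⁻¹).mul_const (d s)⁻¹⁻¹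
    simpa using h
  filter_upwards [hc.tendsto.eventually hκ.source_mem, hd.tendsto.eventually hκ.source_mem,
    h3.eventually hκ.source_mem] with t ht1 ht2 ht3
  simp only [Function.comp, chartMul, κ.left_inv ht1]
  rw [κ.left_inv ht2, κ.left_inv ht3]
  -- With c(s)⁻¹c(t) conjugated by d(s)⁻¹, this is (cd)(s)⁻¹(cd)(t) = [d(s)⁻¹ c(s)⁻¹c(t)
  -- d(s)]·[d(s)⁻¹d(t)].
  group

/-- In the chart, a curve solves the differential equation given by its logarithmic derivative. -/
theorem HasLogDeriv.hasDerivAt_chart (hκ : IsIdentityChart κ) {c : ℝ → G} {w : E} {s : ℝ}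
    (hc : HasLogDeriv κ c w s) (hs : c s ∈ κ.source)
    (hd : HasFDerivAt (fun y => κ (κ.symm (κ (c s)) * κ.symm y)) (leftDeriv κ (κ (c s))) 0) :
    HasDerivAt (fun t => κ (c t)) (leftDeriv κ (κ (c s)) w) s := by
  have h := hd.comp_hasDerivAt_of_eq s hc.2 (by simp [hκ.map_one])
  refine h.congr_of_eventuallyEq ?_
  filter_upwards [hc.tendsto.eventually hκ.source_mem] with t ht
  simp only [Function.comp]
  rw [κ.left_inv ht, κ.left_inv hs, mul_inv_cancel_left]

omit [IsTopologicalGroup G] in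
theorem IsIdentityChart.exists_leftDeriv_bound (hκ : IsIdentityChart κ) :
    ∃ r > 0, ∃ K ≥ 0, K * r ≤ 1 / 2 ∧ ∀ x : E, ‖x‖ ≤ r → x ∈ κ.target ∧
      HasFDerivAt (fun y => κ (κ.symm x * κ.symm y)) (leftDeriv κ x) 0 ∧
      ‖leftDeriv κ x - .id ℝ E‖ ≤ K * ‖x‖ := by
  obtain ⟨K, hK⟩ := hκ.hasFDerivAt_leftDeriv.isBigO_sub.bound
  simp only [hκ.leftDeriv_zero, sub_zero] at hK
  have h1 : ∀ᶠ x in 𝓝 (0 : E), x ∈ κ.target ∧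
      HasFDerivAt (fun y => κ (κ.symm x * κ.symm y)) (leftDeriv κ x) 0 ∧
      ‖leftDeriv κ x - .id ℝ E‖ ≤ K * ‖x‖ := by
    filter_upwards [hκ.target_mem, hκ.eventually_hasFDerivAt_left, hκ.leftDeriv_eventuallyEq, hK]
      with x h1 h2 h3 h4
    exact ⟨h1, h3 ▸ h2, h4⟩
  obtain ⟨r, hr, h⟩ := Metric.eventually_nhds_iff_ball.1 h1
  have hmax : 0 ≤ max K 0 := le_max_right _ _
  -- Halving r puts the closed ball inside the open one; the second bound on the radius gives the
  -- product estimate by 1 / 2.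
  refine ⟨min (r / 2) (1 / (2 * (max K 0 + 1))), by positivity, max K 0, hmax, ?_,
    fun x hx => ?_⟩
  · calc max K 0 * min (r / 2) (1 / (2 * (max K 0 + 1)))
        ≤ max K 0 * (1 / (2 * (max K 0 + 1))) := by gcongr; exact min_le_right _ _
      _ ≤ 1 / 2 := by
        rw [mul_one_div, div_le_div_iff₀ (by positivity) (by norm_num)]
        linarith
  · have hx' : x ∈ Metric.ball (0 : E) r := by
      rw [mem_ball_zero_iff]
      exact (hx.trans (min_le_left _ _)).trans_lt (half_lt_self hr)
    obtain ⟨a, b, c⟩ := h x hx'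
    exact ⟨a, b, c.trans (by gcongr; exact le_max_left _ _)⟩

/-- A curve starting at the identity with small logarithmic derivative stays in the chart, where
it agrees with the primitive of its logarithmic derivative up to second order. -/
theorem IsIdentityChart.exists_bound_of_hasLogDeriv [FiniteDimensional ℝ E] [T2Space G]
    (hκ : IsIdentityChart κ) :
    ∃ δ > 0, ∃ C, ∀ (c : ℝ → G) (w W : ℝ → E) (M : ℝ), c 0 = 1 → W 0 = 0 →
      (∀ s ∈ Icc (0 : ℝ) 1, HasLogDeriv κ c (w s) s) →
      (∀ s ∈ Icc (0 : ℝ) 1, HasDerivAt W (w s) s) →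
      (∀ s ∈ Icc (0 : ℝ) 1, ‖w s‖ ≤ M) → 0 < M → M ≤ δ →
      c 1 ∈ κ.source ∧ ‖κ (c 1) - W 1‖ ≤ C * M ^ 2 := by
  obtain ⟨r, hr, K, hK, hKr, hx⟩ := hκ.exists_leftDeriv_bound
  -- The chart speed stays below 2M, so M ≤ r / 2 confines the curve to radius r. The speed then
  -- differs from w by at most K·(2M)·M, whence the constant 2K.
  refine ⟨r / 2, by positivity, 2 * K, fun c w W M hc0 hW0 hc hW hw hM hMr => ?_⟩
  have hproper : ProperSpace E := FiniteDimensional.proper ℝ E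
  let T : Set G := κ.symm '' Metric.closedBall 0 r
  have hsub : Metric.closedBall (0 : E) r ⊆ κ.target := fun x h =>
    (hx x (mem_closedBall_zero_iff.1 h)).1
  have hT : IsClosed T :=
    ((isCompact_closedBall (0 : E) r).image_of_continuousOn (κ.continuousOn_symm.mono hsub)).isClosed
  have hTmem : ∀ g, g ∈ T ↔ g ∈ κ.source ∧ ‖κ g‖ ≤ r := by
    intro g
    constructor
    · rintro ⟨x, hx1, rfl⟩
      exact ⟨κ.map_target (hsub hx1), by simpa [κ.right_inv (hsub hx1)] using hx1⟩
    · rintro ⟨h1, h2⟩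
      exact ⟨κ g, mem_closedBall_zero_iff.2 h2, κ.left_inv h1⟩
  have hcc : ContinuousOn c (Icc 0 1) := fun s hs => (hc s hs).1.continuousWithinAt
  have hA : IsClosed (Icc (0 : ℝ) 1 ∩ c ⁻¹' T) := hcc.preimage_isClosed_of_isClosed isClosed_Icc hT
  let S : Set ℝ := {s | s ∈ Icc (0 : ℝ) 1 ∩ c ⁻¹' T ∧ ‖κ (c s)‖ ≤ 2 * M * s}
  have hS : IsClosed S := by
    refine hA.isClosed_le (ContinuousOn.norm fun s hs => ?_) (by fun_prop)
    exact ((κ.continuousAt ((hTmem _).1 hs.2).1).comp (hc s hs.1).1).continuousWithinAt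
  have hder : ∀ s ∈ Icc (0 : ℝ) 1, c s ∈ T →
      HasDerivAt (fun t => κ (c t)) (leftDeriv κ (κ (c s)) (w s)) s := fun s hs hT =>
    (hc s hs).hasDerivAt_chart hκ ((hTmem _).1 hT).1 (hx _ ((hTmem _).1 hT).2).2.1
  have herr : ∀ s ∈ Icc (0 : ℝ) 1, c s ∈ T →
      ‖leftDeriv κ (κ (c s)) (w s) - w s‖ ≤ K * ‖κ (c s)‖ * M := by
    intro s hs hT
    have h1 := (leftDeriv κ (κ (c s)) - .id ℝ E).le_opNorm (w s)
    refine (le_trans (by simp) h1).trans ?_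
    have h2 := (hx _ ((hTmem _).1 hT).2).2.2
    have h3 := hw s hs
    gcongr
  -- Continuity argument: S is closed, contains 0, and can be prolonged to the right of each of its
  -- points s < 1.
  have hall : Icc (0 : ℝ) 1 ⊆ S := by
    refine IsClosed.Icc_subset_of_forall_exists_gt (hS.inter isClosed_Icc) ?_ ?_
    · exact ⟨⟨by simp, (hTmem _).2 (by simp [hc0, hκ.one_mem, hκ.map_one, hr.le])⟩,
        by simp [hc0, hκ.map_one]⟩
    · rintro s ⟨⟨⟨hs, hsT⟩, hsb⟩, hs0, hs1⟩ y hy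
      have hd := hder s hs hsT
      -- The speed is at most M + K·r·M ≤ 3M/2. The strict inequality is what prolongs the bound
      -- beyond s.
      have hslope : ‖leftDeriv κ (κ (c s)) (w s)‖ < 2 * M := by
        have h1 := herr s hs hsT
        have h2 : K * ‖κ (c s)‖ * M ≤ 1 / 2 * M := by
          have := ((hTmem _).1 hsT).2
          exact mul_le_mul_of_nonneg_right ((mul_le_mul_of_nonneg_left this hK).trans hKr) hM.le
        have h3 := norm_le_insert' (leftDeriv κ (κ (c s)) (w s)) (w s)
        have h4 := hw s hs
        linarith
      have h1 : ∀ᶠ t in 𝓝[>] s, ‖κ (c t) - κ (c s)‖ ≤ 2 * M * (t - s) := by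
        have h2 := hd.hasDerivWithinAt (s := Ioi s) |>.limsup_norm_slope_le hslope
        filter_upwards [h2, self_mem_nhdsWithin] with t ht ht'
        have hts : 0 < t - s := sub_pos.2 ht'
        rw [Real.norm_of_nonneg hts.le, inv_mul_lt_iff₀ hts] at ht
        linarith
      have h2 : ∀ᶠ t in 𝓝[>] s, c t ∈ κ.source :=
        ((hc s hs).1.eventually (κ.open_source.mem_nhds ((hTmem _).1 hsT).1)).filter_mono
          nhdsWithin_le_nhds
      have h3 : ∀ᶠ t in 𝓝[>] s, t ∈ Ioc s (min y 1) :=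
        Ioc_mem_nhdsGT (lt_min hy hs1)
      obtain ⟨t, ht1, ht2, ht3⟩ := (h1.and (h2.and h3)).exists
      have hty : t ≤ y := ht3.2.trans (min_le_left _ _)
      have ht1' : t ≤ 1 := ht3.2.trans (min_le_right _ _)
      have hb : ‖κ (c t)‖ ≤ 2 * M * t := by
        have := norm_le_insert' (κ (c t)) (κ (c s))
        nlinarith
      refine ⟨t, ⟨⟨⟨hs0.trans ht3.1.le, ht1'⟩, (hTmem _).2 ⟨ht2, hb.trans ?_⟩⟩, hb⟩, ht3.1, hty⟩
      nlinarith
  have h1 := (hall (show (1 : ℝ) ∈ Icc (0 : ℝ) 1 by simp))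
  refine ⟨((hTmem _).1 h1.1.2).1, ?_⟩
  have hmv := (convex_Icc (0 : ℝ) 1).norm_image_sub_le_of_norm_hasDerivWithin_le
    (f := fun t => κ (c t) - W t) (f' := fun s => leftDeriv κ (κ (c s)) (w s) - w s)
    (C := 2 * K * M ^ 2)
    (fun s hs => ((hder s hs (hall hs).1.2).sub (hW s hs)).hasDerivWithinAt)
    (fun s hs => by
      refine (herr s hs (hall hs).1.2).trans ?_
      have h2 : ‖κ (c s)‖ ≤ 2 * M := (hall hs).2.trans (by nlinarith [hs.2])
      calc K * ‖κ (c s)‖ * M ≤ K * (2 * M) * M := by gcongr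
        _ = 2 * K * M ^ 2 := by ring)
    (show (0 : ℝ) ∈ Icc (0 : ℝ) 1 by simp) (show (1 : ℝ) ∈ Icc (0 : ℝ) 1 by simp)
  simpa [hc0, hW0, hκ.map_one] using hmv

/-! ### The derivative of the exponential map -/

variable {E G : Type*} [NormedAddCommGroup E] [NormedSpace ℝ E] [TopologicalSpace G] [Group G]
  {κ : OpenPartialHomeomorph G E} [IsTopologicalGroup G]

namespace IsExponential

variable {e : E → G} (he : IsExponential κ e)
include he

theorem hasLogDeriv (X : E) (s : ℝ) : HasLogDeriv κ (fun t : ℝ => e (t • X)) X s := by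
  have hs : Tendsto (fun t : ℝ => t - s) (𝓝 s) (𝓝 0) := by
    exact Continuous.tendsto' (by fun_prop) _ _ (sub_self s)
  constructor
  · have h1 : (fun t : ℝ => e (t • X)) = fun t => e (s • X) * e ((t - s) • X) := by
      ext t
      rw [← he.add_smul, add_sub_cancel]
    rw [h1]
    have h2 := ((he.continuousAt X).tendsto.comp hs).const_mul (e (s • X))
    simpa [ContinuousAt, Function.comp_def] using h2
  · simp only [he.inv_mul_smul]
    exact HasDerivAt.comp_sub_const s s (by simpa using he.hasDerivAt X)

variable (hκ : IsIdentityChart κ)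
include hκ

omit [IsTopologicalGroup G] in
-- A one-parameter subgroup is commutative, so conjugation by one of its points fixes it.
theorem chartAd_self (X : E) (s : ℝ) : chartAd κ (e (s • X)) X = X := by
  have h1 := (hκ.hasFDerivAt_conj (e (s • X))).comp_hasDerivAt_of_eq (0 : ℝ) (he.hasDerivAt X)
    (by simp [he.map_zero, hκ.map_one])
  refine (h1.congr_of_eventuallyEq ?_).unique (he.hasDerivAt X)
  have h2 : Tendsto (fun t : ℝ => e (t • X)) (𝓝 0) (𝓝 1) := by
    simpa [ContinuousAt, he.map_zero] using he.continuousAt X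
  filter_upwards [h2.eventually hκ.source_mem] with t ht
  simp only [Function.comp, κ.left_inv ht]
  rw [← he.add_smul, add_comm, he.add_smul, mul_inv_cancel_right]

theorem hasDerivAt_chartAd [CompleteSpace E] (X : E) (s : ℝ) :
    HasDerivAt (fun t : ℝ => chartAd κ (e (t • X)))
      (chartBracket κ X * chartAd κ (e (s • X))) s := by
  have h1 : (fun t : ℝ => chartAd κ (e (t • X))) =
      fun t => chartAd κ (e ((t - s) • X)) * chartAd κ (e (s • X)) := by
    ext1 t
    refine Eq.trans ?_ (hκ.chartAd_mul _ _)
    rw [← he.add_smul, sub_add_cancel]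
  rw [h1]
  have h2 : HasDerivAt (fun t : ℝ => chartAd κ (e (t • X))) (chartBracket κ X) 0 :=
    hκ.hasDerivAt_chartAd (by simp [he.map_zero]) (he.continuousAt X) (he.hasDerivAt X)
  exact (HasDerivAt.comp_sub_const s s (by simpa using h2)).mul_const _

/-- Both sides solve f' = -(ad X) f with f(0) = 1. -/
theorem chartAd_neg_smul [CompleteSpace E] {n : ℕ} {X : E} (hX : (chartBracket κ X) ^ n = 0)
    (s : ℝ) : chartAd κ (e (-(s • X))) = negExpSum n (chartBracket κ X) s := by
  have h := eq_negExpSum_of_hasDerivAt hX (f := fun s : ℝ => chartAd κ (e (-(s • X))))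
    (fun t => ?_) (by simpa [he.map_zero] using hκ.chartAd_one.trans ContinuousLinearMap.one_def.symm)
  · exact congrFun h s
  · have h1 := (he.hasDerivAt_chartAd hκ X (-t)).scomp t (hasDerivAt_neg t)
    simpa [Function.comp_def] using h1

variable [FiniteDimensional ℝ E] [T2Space G] {n : ℕ}

/-- The derivative of the exponential map, with a uniform second order error term. -/
theorem exists_bound_inv_mul (hnil : ∀ X : E, (chartBracket κ X) ^ n = 0) (R : ℝ) :
    ∃ δ > 0, ∃ C, ∀ X X' : E, ‖X'‖ ≤ R → ‖X' - X‖ ≤ δ →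
      (e X)⁻¹ * e X' ∈ κ.source ∧
      ‖κ ((e X)⁻¹ * e X') - negExpPrimitive n (chartBracket κ X') 1 (X' - X)‖ ≤
        C * ‖X' - X‖ ^ 2 := by
  have hcomplete : CompleteSpace E := FiniteDimensional.complete ℝ E
  have hproper : ProperSpace E := FiniteDimensional.proper ℝ E
  obtain ⟨δ, hδ, C, hC⟩ := hκ.exists_bound_of_hasLogDeriv
  have hcont : Continuous fun p : E × ℝ => negExpSum n (chartBracket κ p.1) p.2 :=
    (continuous_negExpSum n).comp
      (((chartBracket κ).continuous.comp continuous_fst).prodMk continuous_snd)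
  obtain ⟨P, hP⟩ := ((isCompact_closedBall (0 : E) R).prod
    (isCompact_Icc (a := (0 : ℝ)) (b := 1))).exists_bound_of_continuousOn hcont.continuousOn
  have hP1 : 0 < max P 1 := lt_max_of_lt_right one_pos
  refine ⟨δ / max P 1, by positivity, C * max P 1 ^ 2, fun X X' hX' hXX => ?_⟩
  rcases eq_or_ne X' X with rfl | hne
  · simp [hκ.one_mem, hκ.map_one]
  have hpos : 0 < ‖X' - X‖ := norm_pos_iff.2 (sub_ne_zero.2 hne)
  -- This curve joins 1 to exp(-X) exp(X'), and its logarithmic derivative is of size ‖X' - X‖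
  -- uniformly in s. The factor `max P 1` bounds the series on the compact set and stays positive.
  have h := hC (fun s => e (s • (-X)) * e (s • X'))
    (fun s => negExpSum n (chartBracket κ X') s (X' - X))
    (fun s => negExpPrimitive n (chartBracket κ X') s (X' - X))
    (max P 1 * ‖X' - X‖) (by simp [he.map_zero]) (by simp [negExpPrimitive_zero]) ?_ ?_ ?_
    (by positivity) ?_
  · simp only [one_smul, he.map_neg] at h
    rwa [mul_pow, ← mul_assoc] at h
  · intro s _
    have h1 := (he.hasLogDeriv (-X) s).mul hκ (he.hasLogDeriv X' s)
    -- Since Ad(exp(-sX')) fixes X', the product rule yields Ad(exp(-sX'))(X' - X).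
    have h2 : chartAd κ (e (s • X'))⁻¹ (-X) + X' =
        negExpSum n (chartBracket κ X') s (X' - X) := by
      rw [← he.map_neg (s • X'), ← he.chartAd_neg_smul hκ (hnil X'), map_sub, ← neg_smul,
        he.chartAd_self hκ, _root_.map_neg]
      abel
    rwa [h2] at h1
  · intro s _
    exact (hasDerivAt_negExpPrimitive n (chartBracket κ X') s).clm_apply
      (hasDerivAt_const s (X' - X)) |>.congr_deriv (by simp)
  · intro s hs
    have h1 := hP (X', s) ⟨mem_closedBall_zero_iff.2 hX', hs⟩
    exact (ContinuousLinearMap.le_opNorm _ _).trans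
      (mul_le_mul_of_nonneg_right (h1.trans (le_max_left _ _)) hpos.le)
  · rwa [le_div_iff₀' hP1] at hXX

variable (hnil : ∀ X : E, (chartBracket κ X) ^ n = 0)
include hnil

/-- The uniform bound has F at the moving point p.1; replacing it by F(A) costs only o(p.1 - p.2),
by continuity of F. -/
theorem isLittleO_inv_mul (A : E) :
    (fun p : E × E => κ ((e p.2)⁻¹ * e p.1) -
      negExpPrimitive n (chartBracket κ A) 1 (p.1 - p.2)) =o[𝓝 (A, A)] fun p => p.1 - p.2 := by
  obtain ⟨δ, hδ, C, hC⟩ := he.exists_bound_inv_mul hκ hnil (‖A‖ + 1)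
  have hsub : Tendsto (fun p : E × E => p.1 - p.2) (𝓝 (A, A)) (𝓝 0) :=
    Continuous.tendsto' (by fun_prop) _ _ (sub_self A)
  have h1 : (fun p : E × E => κ ((e p.2)⁻¹ * e p.1) -
      negExpPrimitive n (chartBracket κ p.1) 1 (p.1 - p.2)) =O[𝓝 (A, A)]
        fun p => ‖p.1 - p.2‖ ^ 2 := by
    refine Asymptotics.IsBigO.of_bound C ?_
    have e1 : ∀ᶠ p : E × E in 𝓝 (A, A), ‖p.1 - p.2‖ < δ := by
      simpa using hsub.eventually (Metric.ball_mem_nhds (0 : E) hδ)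
    have e2 : ∀ᶠ p : E × E in 𝓝 (A, A), ‖p.1‖ < ‖A‖ + 1 :=
      (continuous_fst.norm.tendsto (A, A)).eventually (gt_mem_nhds (lt_add_one _))
    filter_upwards [e1, e2] with p h1 h2
    rw [norm_pow, norm_norm]
    exact (hC p.2 p.1 h2.le h1.le).2
  have h2 : (fun p : E × E => ‖p.1 - p.2‖ ^ 2) =o[𝓝 (A, A)] fun p => p.1 - p.2 := by
    have := (Asymptotics.isLittleO_norm_pow_id (E' := E) one_lt_two).comp_tendsto hsub
    exact this
  have hc : Continuous fun X : E => negExpPrimitive n (chartBracket κ X) 1 :=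
    (continuous_negExpPrimitive n 1).comp (chartBracket κ).continuous
  have h3 : (fun p : E × E => (negExpPrimitive n (chartBracket κ p.1) 1 -
      negExpPrimitive n (chartBracket κ A) 1) (p.1 - p.2)) =o[𝓝 (A, A)] fun p => p.1 - p.2 := by
    have h4 : Tendsto (fun p : E × E => ‖negExpPrimitive n (chartBracket κ p.1) 1 -
        negExpPrimitive n (chartBracket κ A) 1‖) (𝓝 (A, A)) (𝓝 0) := by
      have := ((hc.comp continuous_fst).sub
        (continuous_const (y := negExpPrimitive n (chartBracket κ A) 1))).norm.tendsto (A, A)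
      simpa using this
    rw [Asymptotics.isLittleO_iff]
    intro ε hε
    filter_upwards [h4.eventually (gt_mem_nhds hε)] with p hp
    exact (ContinuousLinearMap.le_opNorm _ _).trans
      (mul_le_mul_of_nonneg_right hp.le (norm_nonneg _))
  refine ((h1.trans_isLittleO h2).add h3).congr_left fun p => ?_
  simp

theorem eventually_inv_mul_mem_source (A : E) :
    ∀ᶠ p : E × E in 𝓝 (A, A), (e p.2)⁻¹ * e p.1 ∈ κ.source := by
  obtain ⟨δ, hδ, C, hC⟩ := he.exists_bound_inv_mul hκ hnil (‖A‖ + 1)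
  have hsub : Tendsto (fun p : E × E => p.1 - p.2) (𝓝 (A, A)) (𝓝 0) :=
    Continuous.tendsto' (by fun_prop) _ _ (sub_self A)
  have e1 : ∀ᶠ p : E × E in 𝓝 (A, A), ‖p.1 - p.2‖ < δ := by
    simpa using hsub.eventually (Metric.ball_mem_nhds (0 : E) hδ)
  have e2 : ∀ᶠ p : E × E in 𝓝 (A, A), ‖p.1‖ < ‖A‖ + 1 :=
    (continuous_fst.norm.tendsto (A, A)).eventually (gt_mem_nhds (lt_add_one _))
  filter_upwards [e1, e2] with p h1 h2
  exact (hC p.2 p.1 h2.le h1.le).1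

theorem tendsto_chart_inv_mul (A : E) :
    Tendsto (fun p : E × E => κ ((e p.2)⁻¹ * e p.1)) (𝓝 (A, A)) (𝓝 0) := by
  have hsub : Tendsto (fun p : E × E => p.1 - p.2) (𝓝 (A, A)) (𝓝 0) :=
    Continuous.tendsto' (by fun_prop) _ _ (sub_self A)
  have h1 := (he.isLittleO_inv_mul hκ hnil A).isBigO.trans_tendsto hsub
  have h2 := ((negExpPrimitive n (chartBracket κ A) 1).continuous.tendsto 0).comp hsub
  simpa using h1.add h2

theorem continuous : Continuous e := by
  rw [continuous_iff_continuousAt]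
  intro A
  have h0 : Tendsto (fun X : E => (X, A)) (𝓝 A) (𝓝 (A, A)) :=
    (Continuous.prodMk_left A).tendsto A
  have h1 := hκ.tendsto_symm.comp ((he.tendsto_chart_inv_mul hκ hnil A).comp h0)
  have h2 : Tendsto (fun X => (e A)⁻¹ * e X) (𝓝 A) (𝓝 1) := by
    refine h1.congr' ?_
    filter_upwards [h0.eventually (he.eventually_inv_mul_mem_source hκ hnil A)] with X hX
    exact κ.left_inv hX
  simpa [ContinuousAt] using h2.const_mul (e A)

/-- Factor exp(A)⁻¹exp(X) = [exp(A)⁻¹exp(Y)]·[exp(Y)⁻¹exp(X)]. The chart product is strictly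
differentiable at the origin with derivative the sum, so the increment from Y to X is the second
factor up to o(X - Y). -/
theorem hasStrictFDerivAt (A : E) : HasStrictFDerivAt (fun X => κ ((e A)⁻¹ * e X))
    (negExpPrimitive n (chartBracket κ A) 1) A := by
  refine .of_isLittleO ?_
  have hm := hκ.hasStrictFDerivAt_chartMul.isLittleO
  have h0 : Tendsto (fun p : E × E => (p.2, A)) (𝓝 (A, A)) (𝓝 (A, A)) :=
    ((continuous_snd.prodMk continuous_const).tendsto' _ _ rfl)
  have h0' : Tendsto (fun p : E × E => (p.1, A)) (𝓝 (A, A)) (𝓝 (A, A)) :=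
    ((continuous_fst.prodMk continuous_const).tendsto' _ _ rfl)
  have hx := (he.tendsto_chart_inv_mul hκ hnil A).comp h0
  have hy := he.tendsto_chart_inv_mul hκ hnil A
  have hpair : Tendsto (fun p : E × E => ((κ ((e A)⁻¹ * e p.2), κ ((e p.2)⁻¹ * e p.1)),
      (κ ((e A)⁻¹ * e p.2), (0 : E)))) (𝓝 (A, A)) (𝓝 ((0, 0), (0, 0))) :=
    (hx.prodMk_nhds hy).prodMk_nhds (hx.prodMk_nhds tendsto_const_nhds)
  have h1 := hm.comp_tendsto hpair
  have hsmall := he.isLittleO_inv_mul hκ hnil A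
  have hbig : (fun p : E × E => κ ((e p.2)⁻¹ * e p.1)) =O[𝓝 (A, A)] fun p => p.1 - p.2 := by
    have h2 := (negExpPrimitive n (chartBracket κ A) 1).isBigO_comp
      (fun p : E × E => p.1 - p.2) (𝓝 (A, A))
    simpa using hsmall.isBigO.add h2
  have h2 : (fun p : E × E => chartMul κ (κ ((e A)⁻¹ * e p.2), κ ((e p.2)⁻¹ * e p.1)) -
      chartMul κ (κ ((e A)⁻¹ * e p.2), 0) - κ ((e p.2)⁻¹ * e p.1)) =o[𝓝 (A, A)]
        fun p => p.1 - p.2 := by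
    have h3 : (fun p : E × E => ((κ ((e A)⁻¹ * e p.2), κ ((e p.2)⁻¹ * e p.1)) : E × E) -
      (κ ((e A)⁻¹ * e p.2), 0)) =O[𝓝 (A, A)] fun p => p.1 - p.2 := by
      refine Asymptotics.IsBigO.trans (Asymptotics.IsBigO.of_bound 1 ?_) hbig
      filter_upwards with p
      simp [Prod.norm_def]
    refine (h1.trans_isBigO h3).congr_left fun p => ?_
    simp
  refine (h2.add hsmall).congr' ?_ EventuallyEq.rfl
  filter_upwards [he.eventually_inv_mul_mem_source hκ hnil A,
    h0.eventually (he.eventually_inv_mul_mem_source hκ hnil A),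
    hx.eventually hκ.chartMul_zero_right] with p hp1 hp2 hp3
  simp only [Function.comp] at hp3
  rw [hp3, chartMul, κ.left_inv hp1, κ.left_inv hp2]
  simp [mul_assoc]

end IsExponential

/-! ### Graded algebra: nilpotency, invertibility of F, dilations -/

section Grading

variable {E : Type*} [NormedAddCommGroup E] [NormedSpace ℝ E]

/-- The maps `π i` are the projections onto the layers of a grading, with degrees in `[1, υ]`, that
is compatible with the bilinear map `br`. -/
structure IsGrading (υ : ℕ) (br : E →L[ℝ] E →L[ℝ] E) (π : ℕ → E →L[ℝ] E) : Prop where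
  bracket : ∀ j X Y, π j (br X Y) =
    ∑ p ∈ Finset.HasAntidiagonal.antidiagonal j, br (π p.1 X) (π p.2 Y)
  sum : ∀ X, ∑ i ∈ Finset.Icc 1 υ, π i X = X
  proj_self : ∀ i X, π i (π i X) = π i X
  proj_of_ne : ∀ i j X, i ≠ j → π i (π j X) = 0
  eq_zero : ∀ i, i ∉ Finset.Icc 1 υ → π i = 0

/-- The dilations of a graded vector space. -/
def dil (π : ℕ → E →L[ℝ] E) (υ : ℕ) (r : ℝ) (X : E) : E := ∑ i ∈ Finset.Icc 1 υ, r ^ i • π i X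

namespace IsGrading

variable {υ : ℕ} {br : E →L[ℝ] E →L[ℝ] E} {π : ℕ → E →L[ℝ] E} (hπ : IsGrading υ br π)
include hπ

theorem zero : π 0 = 0 := hπ.eq_zero 0 (by simp)

theorem ext {X Y : E} (h : ∀ i, π i X = π i Y) : X = Y := by
  rw [← hπ.sum X, ← hπ.sum Y]
  exact Finset.sum_congr rfl fun i _ => h i

theorem eq_zero_of_isEmpty (hυ : υ = 0) (X : E) : X = 0 := by
  rw [← hπ.sum X, hυ]
  simp

theorem norm_le_sum (X : E) : ‖X‖ ≤ ∑ i ∈ Finset.Icc 1 υ, ‖π i X‖ := by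
  conv_lhs => rw [← hπ.sum X]
  exact norm_sum_le _ _

/-- The bracket raises degrees, so its components are bounded by those of lower degree. -/
theorem norm_proj_bracket_le {i : ℕ} {X Z : E} {a b L H : ℝ} (ha : 0 ≤ a) (hb : 0 ≤ b)
    (hL : 0 ≤ L) (hH : 0 ≤ H)
    (hX : ∀ p < i, ‖π p X‖ ≤ a * L ^ p) (hZ : ∀ q < i, ‖π q Z‖ ≤ b * L ^ (q - 1) * H) :
    ∀ j ≤ i, ‖π j (br X Z)‖ ≤ ((i + 1) * ‖br‖ * a * b) * L ^ (j - 1) * H := by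
  intro j hj
  have h1 : ∀ p ∈ Finset.HasAntidiagonal.antidiagonal j,
      ‖br (π p.1 X) (π p.2 Z)‖ ≤ ‖br‖ * a * b * L ^ (j - 1) * H := by
    intro p hp
    rw [Finset.HasAntidiagonal.mem_antidiagonal] at hp
    -- The hypotheses only cover degrees below i, and q - 1 is truncated at q = 0. The pairs with a
    -- zero entry are harmless because π 0 = 0.
    by_cases h : p.1 = 0 ∨ p.2 = 0
    · have h0 : br (π p.1 X) (π p.2 Z) = 0 := by
        rcases h with h | h <;> simp [h, hπ.zero]
      rw [h0, norm_zero]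
      positivity
    · calc ‖br (π p.1 X) (π p.2 Z)‖ ≤ ‖br‖ * ‖π p.1 X‖ * ‖π p.2 Z‖ := br.le_opNorm₂ _ _
        _ ≤ ‖br‖ * (a * L ^ p.1) * (b * L ^ (p.2 - 1) * H) := by
          gcongr
          · exact hX _ (by omega)
          · exact hZ _ (by omega)
        _ = ‖br‖ * a * b * (L ^ p.1 * L ^ (p.2 - 1)) * H := by ring
        _ = ‖br‖ * a * b * L ^ (j - 1) * H := by
          rw [← pow_add, show p.1 + (p.2 - 1) = j - 1 by omega]
  rw [hπ.bracket]
  refine (norm_sum_le_of_le _ h1).trans ?_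
  rw [Finset.sum_const, Finset.Nat.card_antidiagonal, nsmul_eq_mul]
  have h2 : ((j + 1 : ℕ) : ℝ) ≤ (i + 1 : ℝ) := by exact_mod_cast Nat.succ_le_succ hj
  calc ((j + 1 : ℕ) : ℝ) * (‖br‖ * a * b * L ^ (j - 1) * H)
      ≤ (i + 1 : ℝ) * (‖br‖ * a * b * L ^ (j - 1) * H) := by gcongr
    _ = _ := by ring

theorem proj_bracket_eq_zero {i : ℕ} {X Z : E} (hZ : ∀ q < i, π q Z = 0) :
    ∀ j ≤ i, π j (br X Z) = 0 := by
  intro j hj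
  rw [hπ.bracket]
  refine Finset.sum_eq_zero fun p hp => ?_
  rw [Finset.HasAntidiagonal.mem_antidiagonal] at hp
  rcases Nat.eq_zero_or_pos p.1 with h | h
  · simp [h, hπ.zero]
  · rw [hZ p.2 (by omega), _root_.map_zero]

theorem proj_bracket_pow_eq_zero (X Z : E) (k : ℕ) : ∀ j ≤ k, π j ((br X ^ k) Z) = 0 := by
  induction k with
  | zero =>
    intro j hj
    rw [Nat.le_zero.1 hj, hπ.zero, zero_apply]
  | succ k ih =>
    intro j hj
    rw [pow_succ', mul_apply_eq_comp]
    exact hπ.proj_bracket_eq_zero (i := k + 1) (fun q hq => ih q (by omega)) j hj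

theorem bracket_pow_eq_zero (X : E) : br X ^ υ = 0 := by
  ext Z
  refine hπ.ext fun i => ?_
  by_cases hi : i ∈ Finset.Icc 1 υ
  · rw [hπ.proj_bracket_pow_eq_zero X Z υ i (Finset.mem_Icc.1 hi).2]; simp
  · simp [hπ.eq_zero i hi]

/-- The left logarithmic derivative of the exponential map is the identity up to brackets. -/
theorem negExpPrimitive_apply (X Z : E) : negExpPrimitive υ (br X) 1 Z =
    Z - ∑ n ∈ Finset.Icc 2 υ, ((-1 : ℝ) ^ n / (n.factorial : ℝ)) • (br X ^ (n - 1)) Z := by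
  rcases Nat.eq_zero_or_pos υ with h | h
  · rw [hπ.eq_zero_of_isEmpty h (negExpPrimitive υ (br X) 1 Z), hπ.eq_zero_of_isEmpty h (Z - _)]
  obtain ⟨m, rfl⟩ : ∃ m, υ = m + 1 := ⟨υ - 1, by omega⟩
  -- The term k = 0 of the series is Z. The term k = n - 1 matches the summand n, with sign
  -- (-1)^(n-1) = -(-1)^n.
  have h2 : Finset.Icc 2 (m + 1) = Finset.Ico (0 + 2) (m + 2) := by
    ext
    simp
    omega
  have h3 := Finset.sum_Ico_add' (fun n => ((-1 : ℝ) ^ n / (n.factorial : ℝ)) •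
    (br X ^ (n - 1)) Z) 0 m 2
  rw [negExpPrimitive, Finset.sum_range_succ', h2, ← h3, sub_eq_add_neg, ← Finset.sum_neg_distrib, add_comm Z, ← Finset.range_eq_Ico]
  simp [pow_succ, neg_div]

theorem proj_one_negExpPrimitive (X Z : E) : π 1 (negExpPrimitive υ (br X) 1 Z) = π 1 Z := by
  rw [hπ.negExpPrimitive_apply, map_sub, map_sum, Finset.sum_eq_zero, sub_zero]
  intro n hn
  rw [map_smul, hπ.proj_bracket_pow_eq_zero _ _ _ 1 (by have := Finset.mem_Icc.1 hn; omega),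
    smul_zero]

/-- The map is the identity plus terms raising the degree. A vector in its kernel therefore vanishes
layer by layer, and injectivity suffices in finite dimension. -/
theorem exists_equiv (X : E) [FiniteDimensional ℝ E] :
    ∃ T : E ≃L[ℝ] E, (T : E →L[ℝ] E) = negExpPrimitive υ (br X) 1 := by
  have hinj : Function.Injective
        ((negExpPrimitive υ (br X) 1 : E →L[ℝ] E) : E →ₗ[ℝ] E) := by
    rw [injective_iff_map_eq_zero]
    intro Z hZ
    have hZ' : negExpPrimitive υ (br X) 1 Z = 0 := hZ
    rw [hπ.negExpPrimitive_apply, sub_eq_zero] at hZ'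
    have key : ∀ j, π j Z = 0 := by
      intro j
      induction j using Nat.strong_induction_on with
      | _ j ih =>
        have hk : ∀ k, ∀ i ≤ j, π i ((br X ^ (k + 1)) Z) = 0 := by
          intro k
          induction k with
          | zero => simpa using hπ.proj_bracket_eq_zero ih
          | succ k ihk =>
            intro i hi
            rw [pow_succ', mul_apply_eq_comp]
            exact hπ.proj_bracket_eq_zero (i := j) (fun q hq => ihk q hq.le) i hi
        rw [hZ', map_sum]
        refine Finset.sum_eq_zero fun n hn => ?_
        have h2 : n - 1 = (n - 2) + 1 := by have := Finset.mem_Icc.1 hn; omega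
        rw [map_smul, h2, hk _ j le_rfl, smul_zero]
    exact hπ.ext fun i => by rw [key i, _root_.map_zero]
  exact ⟨(LinearEquiv.ofInjectiveEndo _ hinj).toContinuousLinearEquiv, by ext; rfl⟩

theorem proj_dil (r : ℝ) (X : E) (i : ℕ) : π i (dil π υ r X) = r ^ i • π i X := by
  rw [dil, map_sum]
  by_cases hi : i ∈ Finset.Icc 1 υ
  · rw [Finset.sum_eq_single_of_mem i hi]
    · rw [map_smul, hπ.proj_self]
    · intro j _ hj
      rw [map_smul, hπ.proj_of_ne i j X hj.symm, smul_zero]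
  · simp [hπ.eq_zero i hi]

omit hπ in
theorem dil_zero_left (X : E) : dil π υ 0 X = 0 := by
  refine Finset.sum_eq_zero fun i hi => ?_
  rw [zero_pow (by have := Finset.mem_Icc.1 hi; omega), zero_smul]

omit hπ in
theorem dil_zero_right (r : ℝ) : dil π υ r (0 : E) = 0 := by simp [dil]

omit hπ in
theorem continuous_dil (X : E) : Continuous fun r : ℝ => dil π υ r X := by
  unfold dil
  fun_prop

theorem exists_norm_dil_eq_one {X : E} (hX : X ≠ 0) : ∃ r > 0, ‖dil π υ r X‖ = 1 := by
  obtain ⟨i, hi⟩ : ∃ i, π i X ≠ 0 := by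
    by_contra! h
    exact hX (hπ.ext fun i => by rw [h i, _root_.map_zero])
  have hi1 : 1 ≤ i := by
    by_contra h
    rw [show i = 0 by omega, hπ.zero] at hi
    exact hi rfl
  have hpos : 0 < ‖π i X‖ := norm_pos_iff.2 hi
  have hπi : 0 < ‖π i‖ := norm_pos_iff.2 fun h => hi (by rw [h]; rfl)
  -- Since R ≥ 1 and i ≥ 1, R^i ≥ R. So the degree i component of the dilated vector has norm at
  -- least ‖π i‖, which forces the whole vector to have norm at least 1.
  let R : ℝ := max 1 (‖π i‖ / ‖π i X‖)
  have hR1 : 1 ≤ R := le_max_left _ _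
  have hR : 1 ≤ ‖dil π υ R X‖ := by
    have h1 := (π i).le_opNorm (dil π υ R X)
    rw [hπ.proj_dil, norm_smul, norm_pow, Real.norm_of_nonneg (by positivity)] at h1
    have h2 : ‖π i‖ ≤ R ^ i * ‖π i X‖ := by
      calc ‖π i‖ = ‖π i‖ / ‖π i X‖ * ‖π i X‖ := by field_simp
        _ ≤ R ^ i * ‖π i X‖ := by
          gcongr
          exact (le_max_right _ _).trans (le_self_pow₀ hR1 (by omega))
    exact le_of_mul_le_mul_left (by linarith) hπi
  have hc : ContinuousOn (fun r : ℝ => ‖dil π υ r X‖) (Icc 0 R) :=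
    (continuous_dil X).norm.continuousOn
  obtain ⟨r, hr, hr1⟩ := intermediate_value_Icc (by linarith) hc
    (show (1 : ℝ) ∈ Icc _ _ from ⟨by simp [dil_zero_left], hR⟩)
  refine ⟨r, lt_of_le_of_ne hr.1 ?_, hr1⟩
  rintro rfl
  simp [dil_zero_left] at hr1

end IsGrading

end Grading

/-! ### Homogeneous distances compared with graded coordinates -/

/-- A homogeneous distance on a group with dilations read through the map `e`. -/
structure IsHomDist {E G : Type*} [NormedAddCommGroup E] [NormedSpace ℝ E] [TopologicalSpace G]
    [Group G] (π : ℕ → E →L[ℝ] E) (υ : ℕ) (e : E → G) (ρ : G → G → ℝ) : Prop where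
  eq_zero_iff : ∀ x y, ρ x y = 0 ↔ x = y
  symm : ∀ x y, ρ x y = ρ y x
  triangle : ∀ x y z, ρ x z ≤ ρ x y + ρ y z
  continuous : Continuous fun p : G × G => ρ p.1 p.2
  left_invariant : ∀ z x y, ρ (z * x) (z * y) = ρ x y
  homogeneous : ∀ r : ℝ, 0 < r → ∀ X Y : E, ρ (e (dil π υ r X)) (e (dil π υ r Y)) = r * ρ (e X) (e Y)

namespace IsHomDist

variable {E G : Type*} [NormedAddCommGroup E] [NormedSpace ℝ E] [TopologicalSpace G] [Group G]
  {π : ℕ → E →L[ℝ] E} {υ : ℕ} {e : E → G} {ρ : G → G → ℝ} (hρ : IsHomDist π υ e ρ)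
include hρ

theorem self (x : G) : ρ x x = 0 := (hρ.eq_zero_iff x x).2 rfl

theorem nonneg (x y : G) : 0 ≤ ρ x y := by
  have h := hρ.triangle x y x
  rw [hρ.self, hρ.symm y x] at h
  linarith

theorem eq_one_inv_mul (x y : G) : ρ x y = ρ 1 (x⁻¹ * y) := by
  rw [← hρ.left_invariant x⁻¹, inv_mul_cancel]

theorem homogeneous_one (h0 : e 0 = 1) {r : ℝ} (hr : 0 < r) (X : E) :
    ρ 1 (e (dil π υ r X)) = r * ρ 1 (e X) := by
  have h := hρ.homogeneous r hr 0 X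
  rwa [IsGrading.dil_zero_right, h0] at h

variable {br : E →L[ℝ] E →L[ℝ] E} (hπ : IsGrading υ br π)
include hπ

/-- If the exponential map is injective near zero, it is injective, by homogeneity. -/
theorem injective {U : Set E} (hU : U ∈ 𝓝 (0 : E)) (hinj : InjOn e U) : Function.Injective e := by
  intro X Y hXY
  have hX : ∀ Z : E, ∀ᶠ r in 𝓝[>] (0 : ℝ), dil π υ r Z ∈ U := by
    intro Z
    have h1 : Tendsto (fun r : ℝ => dil π υ r Z) (𝓝 0) (𝓝 0) :=
      (IsGrading.continuous_dil Z).tendsto' _ _ (IsGrading.dil_zero_left Z)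
    exact (h1.eventually hU).filter_mono nhdsWithin_le_nhds
  obtain ⟨r, ⟨h1, h2⟩, hr⟩ := (((hX X).and (hX Y)).and self_mem_nhdsWithin).exists
  have hr : 0 < r := hr
  have h3 : dil π υ r X = dil π υ r Y := by
    refine hinj h1 h2 ((hρ.eq_zero_iff _ _).1 ?_)
    rw [hρ.homogeneous r hr, hXY, hρ.self, mul_zero]
  refine hπ.ext fun i => ?_
  have h4 := congrArg (π i) h3
  rw [hπ.proj_dil, hπ.proj_dil] at h4
  exact smul_right_injective E (pow_ne_zero i hr.ne') h4

variable [FiniteDimensional ℝ E] (hc : Continuous e) (hinj : Function.Injective e) (h0 : e 0 = 1)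
include hc h0

/-- The components of `X` are bounded by powers of the distance of `exp X` from the identity. -/
theorem exists_norm_proj_le (hinj : Function.Injective e) :
    ∃ C > 0, ∀ (X : E) (j : ℕ), ‖π j X‖ ≤ C * ρ 1 (e X) ^ j := by
  have hproper : ProperSpace E := FiniteDimensional.proper ℝ E
  have hcont : Continuous fun X : E => ρ 1 (e X) :=
    hρ.continuous.comp (continuous_const.prodMk hc)
  -- The minimum over the compact unit sphere is positive because e is injective; the sphere is
  -- empty when E is trivial.
  obtain ⟨m, hm, hmin⟩ : ∃ m > 0, ∀ X : E, ‖X‖ = 1 → m ≤ ρ 1 (e X) := by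
    rcases (Metric.sphere (0 : E) 1).eq_empty_or_nonempty with h | h
    · refine ⟨1, one_pos, fun X hX => ?_⟩
      have : X ∈ Metric.sphere (0 : E) 1 := by simpa using hX
      simp [h] at this
    · obtain ⟨Y, hY, hYmin⟩ := (isCompact_sphere (0 : E) 1).exists_isMinOn h hcont.continuousOn
      refine ⟨ρ 1 (e Y), lt_of_le_of_ne (hρ.nonneg _ _) fun h1 => ?_, fun X hX =>
        hYmin (by simpa using hX)⟩
      have h2 := (hρ.eq_zero_iff _ _).1 h1.symm
      rw [← h0] at h2
      have h3 := hinj h2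
      rw [← h3] at hY
      simp at hY
  let P : ℝ := ∑ i ∈ Finset.Icc 1 υ, ‖π i‖ * m⁻¹ ^ i
  have hP : ∀ i, ‖π i‖ * m⁻¹ ^ i ≤ P + 1 := by
    intro i
    by_cases hi : i ∈ Finset.Icc 1 υ
    · have := Finset.single_le_sum (f := fun i => ‖π i‖ * m⁻¹ ^ i) (fun i _ => by positivity) hi
      linarith
    · rw [hπ.eq_zero i hi, norm_zero, zero_mul]
      positivity
  refine ⟨P + 1, by positivity, fun X j => ?_⟩
  rcases eq_or_ne X 0 with rfl | hX
  · rw [_root_.map_zero, norm_zero]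
    exact mul_nonneg (by positivity) (pow_nonneg (hρ.nonneg _ _) _)
  obtain ⟨r, hr, hr1⟩ := hπ.exists_norm_dil_eq_one hX
  have h1 := hmin _ hr1
  rw [hρ.homogeneous_one h0 hr] at h1
  have h2 : r⁻¹ ≤ m⁻¹ * ρ 1 (e X) := by
    rw [inv_mul_eq_div, inv_eq_one_div, div_le_div_iff₀ hr hm]
    linarith
  have h3 : π j X = r⁻¹ ^ j • π j (dil π υ r X) := by
    rw [hπ.proj_dil, smul_smul, ← mul_pow, inv_mul_cancel₀ hr.ne', one_pow, one_smul]
  calc ‖π j X‖ = r⁻¹ ^ j * ‖π j (dil π υ r X)‖ := by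
        rw [h3, norm_smul, norm_pow, Real.norm_of_nonneg (by positivity)]
    _ ≤ (m⁻¹ * ρ 1 (e X)) ^ j * ‖π j‖ := by
        have := hρ.nonneg 1 (e X)
        gcongr
        simpa [hr1] using (π j).le_opNorm (dil π υ r X)
    _ = ‖π j‖ * m⁻¹ ^ j * ρ 1 (e X) ^ j := by ring
    _ ≤ _ := mul_le_mul_of_nonneg_right (hP j) (pow_nonneg (hρ.nonneg _ _) _)

/-- Homogeneous bounds on the components of `X` bound the distance of `exp X` from the identity. -/
theorem exists_le_of_norm_proj_le (K : ℝ) :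
    ∃ C > 0, ∀ (X : E) (L : ℝ), 0 ≤ L → (∀ j ∈ Finset.Icc 1 υ, ‖π j X‖ ≤ K * L ^ j) →
      ρ 1 (e X) ≤ C * L := by
  have hproper : ProperSpace E := FiniteDimensional.proper ℝ E
  have hcont : Continuous fun X : E => ρ 1 (e X) :=
    hρ.continuous.comp (continuous_const.prodMk hc)
  -- Dilating X by L⁻¹ leaves υ components of norm at most K, hence this radius.
  obtain ⟨C, hC⟩ := (isCompact_closedBall (0 : E) (υ * K)).exists_bound_of_continuousOn
    hcont.continuousOn
  refine ⟨max C 1, lt_max_of_lt_right one_pos, fun X L hL hX => ?_⟩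
  rcases hL.eq_or_lt with rfl | hL
  · have : X = 0 := by
      rw [← hπ.sum X]
      refine Finset.sum_eq_zero fun i hi => ?_
      have h1 := hX i hi
      rw [zero_pow (by have := Finset.mem_Icc.1 hi; omega), mul_zero] at h1
      exact norm_le_zero_iff.1 h1
    rw [this, h0, hρ.self, mul_zero]
  have h1 : dil π υ L⁻¹ X ∈ Metric.closedBall (0 : E) (υ * K) := by
    rw [mem_closedBall_zero_iff]
    refine (hπ.norm_le_sum _).trans ?_
    refine (Finset.sum_le_card_nsmul _ _ K fun i hi => ?_).trans_eq (by simp)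
    rw [hπ.proj_dil, norm_smul, norm_pow, Real.norm_of_nonneg (by positivity), inv_pow,
      inv_mul_le_iff₀ (by positivity), mul_comm]
    exact hX i hi
  have h2 := hC _ h1
  rw [Real.norm_of_nonneg (hρ.nonneg _ _), hρ.homogeneous_one h0 (by positivity),
    inv_mul_le_iff₀ hL] at h2
  calc ρ 1 (e X) ≤ L * C := h2
    _ ≤ max C 1 * L := by rw [mul_comm]; gcongr; exact le_max_left _ _

end IsHomDist

/-! ### Global exponential coordinates -/

section Homeomorph

variable {E G : Type*} [NormedAddCommGroup E] [NormedSpace ℝ E] [FiniteDimensional ℝ E]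
  [TopologicalSpace G] [Group G] [IsTopologicalGroup G] [T2Space G]
  {κ : OpenPartialHomeomorph G E} {e : E → G} {υ : ℕ} {π : ℕ → E →L[ℝ] E}

namespace IsExponential

variable (he : IsExponential κ e) (hκ : IsIdentityChart κ) (hπ : IsGrading υ (chartBracket κ) π)
include he hκ hπ

/-- The inverse function theorem for the chart of exp(A)⁻¹exp(X), whose derivative F(A) is
invertible, carried to exp A by left translation. It makes exp open. -/
theorem nhds_le_map (A : E) : 𝓝 (e A) ≤ map e (𝓝 A) := by
  have hcomplete : CompleteSpace E := FiniteDimensional.complete ℝ E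
  have hs := he.hasStrictFDerivAt hκ hπ.bracket_pow_eq_zero A
  obtain ⟨T, hT⟩ := hπ.exists_equiv A
  rw [← hT] at hs
  have hmap := hs.map_nhds_eq_of_equiv
  intro S hS
  have h0 : Tendsto (fun X : E => (X, A)) (𝓝 A) (𝓝 (A, A)) :=
    (Continuous.prodMk_left A).tendsto A
  have h1 : e ⁻¹' S ∩ {X | (e A)⁻¹ * e X ∈ κ.source} ∈ 𝓝 A :=
    inter_mem hS (h0.eventually (he.eventually_inv_mul_mem_source hκ hπ.bracket_pow_eq_zero A))
  have h2 := image_mem_map (m := fun X => κ ((e A)⁻¹ * e X)) h1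
  rw [hmap, inv_mul_cancel, hκ.map_one] at h2
  have h3 : Tendsto (fun g => (e A)⁻¹ * g) (𝓝 (e A)) (𝓝 1) := by
    simpa using (continuous_const_mul (e A)⁻¹).tendsto (e A)
  filter_upwards [h3.eventually hκ.source_mem, (hκ.tendsto_one.comp h3).eventually h2]
    with g hg hg2
  obtain ⟨X, ⟨hXS, hX⟩, hXg⟩ := hg2
  have h4 := mul_left_cancel (κ.injOn hX hg hXg)
  exact h4 ▸ hXS

theorem exists_injOn : ∃ U ∈ 𝓝 (0 : E), InjOn e U := by
  have hcomplete : CompleteSpace E := FiniteDimensional.complete ℝ E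
  have hs := he.hasStrictFDerivAt hκ hπ.bracket_pow_eq_zero 0
  obtain ⟨T, hT⟩ := hπ.exists_equiv 0
  rw [← hT] at hs
  refine ⟨_, hs.eventually_left_inverse, fun X hX Y hY hXY => ?_⟩
  have hX' : hs.localInverse _ _ _ (κ ((e 0)⁻¹ * e X)) = X := hX
  have hY' : hs.localInverse _ _ _ (κ ((e 0)⁻¹ * e Y)) = Y := hY
  rw [← hX', ← hY', hXY]

variable {ρ : G → G → ℝ} (hρ : IsHomDist π υ e ρ)
include hρ

/-- The exponential map of a connected group with a homogeneous distance is a homeomorphism. -/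
theorem exists_homeomorph [ConnectedSpace G] : ∃ Φ : E ≃ₜ G, ⇑Φ = e := by
  have hproper : ProperSpace E := FiniteDimensional.proper ℝ E
  have hc := he.continuous hκ hπ.bracket_pow_eq_zero
  obtain ⟨U, hU, hUinj⟩ := he.exists_injOn hκ hπ
  have hinj := hρ.injective hπ hU hUinj
  have hopen : IsOpenMap e := IsOpenMap.of_nhds_le (he.nhds_le_map hκ hπ)
  obtain ⟨C, hC, hle⟩ := hρ.exists_norm_proj_le hπ hc he.map_zero hinj
  -- Near a limit g of the range, ρ(1, ·) is below ρ(1, g) + 1, so the nearby points of the range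
  -- lie in the image of a fixed closed ball, which is compact.
  have hclosed : IsClosed (range e) := by
    refine isClosed_of_closure_subset fun g hg => ?_
    have hW : IsOpen {h : G | ρ 1 h < ρ 1 g + 1} :=
      isOpen_lt (hρ.continuous.comp (continuous_const.prodMk continuous_id)) continuous_const
    have h1 : g ∈ closure ({h : G | ρ 1 h < ρ 1 g + 1} ∩ range e) :=
      hW.inter_closure ⟨by simp, hg⟩
    have hK := ((isCompact_closedBall (0 : E)
      (∑ i ∈ Finset.Icc 1 υ, C * (ρ 1 g + 1) ^ i)).image hc).isClosed
    have h2 : {h : G | ρ 1 h < ρ 1 g + 1} ∩ range e ⊆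
        e '' Metric.closedBall (0 : E) (∑ i ∈ Finset.Icc 1 υ, C * (ρ 1 g + 1) ^ i) := by
      rintro _ ⟨hX, X, rfl⟩
      refine ⟨X, mem_closedBall_zero_iff.2 ((hπ.norm_le_sum X).trans ?_), rfl⟩
      refine Finset.sum_le_sum fun i _ => (hle X i).trans ?_
      have hX : ρ 1 (e X) < ρ 1 g + 1 := hX
      have := hρ.nonneg 1 (e X)
      gcongr
    exact image_subset_range _ _ (closure_minimal h2 hK h1)
  have hsurj : range e = univ :=
    IsClopen.eq_univ ⟨hclosed, hopen.isOpen_range⟩ (range_nonempty e)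
  exact ⟨(Equiv.ofBijective e ⟨hinj, range_eq_univ.1 hsurj⟩).toHomeomorphOfContinuousOpen hc hopen,
    rfl⟩

omit hρ in
/-- The derivative of left translations in exponential coordinates. -/
theorem hasFDerivAt_leftTranslation {Φ : E ≃ₜ G} (hΦ : ⇑Φ = e) (A X : E) (T : E ≃L[ℝ] E)
    (hT : (T : E →L[ℝ] E) =
      negExpPrimitive υ (chartBracket κ (Φ.symm (e A * e X))) 1) :
    HasFDerivAt (fun Y => Φ.symm (e A * e Y))
      ((T.symm : E →L[ℝ] E).comp (negExpPrimitive υ (chartBracket κ X) 1)) X := by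
  have hcomplete : CompleteSpace E := FiniteDimensional.complete ℝ E
  have hc := he.continuous hκ hπ.bracket_pow_eq_zero
  have heΦ : ∀ g, e (Φ.symm g) = g := fun g => by rw [← hΦ, Φ.apply_symm_apply]
  set P := Φ.symm (e A * e X) with hP
  have hs := he.hasStrictFDerivAt hκ hπ.bracket_pow_eq_zero P
  rw [← hT] at hs
  have hX := (he.hasStrictFDerivAt hκ hπ.bracket_pow_eq_zero X).hasFDerivAt
  have h1 := HasFDerivAt.comp X (by simpa using hs.to_localInverse.hasFDerivAt) hX
  refine h1.congr_of_eventuallyEq ?_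
  have hl : Tendsto (fun Y => Φ.symm (e A * e Y)) (𝓝 X) (𝓝 P) :=
    (Φ.symm.continuous.comp (continuous_const.mul hc)).tendsto X
  filter_upwards [hl.eventually hs.eventually_left_inverse] with Y hY
  -- With exp P = exp(A) exp(X), the translation factors through exp(P)⁻¹ exp(A) exp(Y) = exp(X)⁻¹
  -- exp(Y), followed by the local inverse at P.
  refine hY.symm.trans ?_
  simp only [Function.comp]
  congr 2
  rw [heΦ, heΦ]
  group

end IsExponential

end Homeomorph

/-! ### Absolutely continuous curves in vector and metric spaces -/

section AbsolutelyContinuous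

open AbsolutelyContinuousOnInterval

/-- Every transfer of absolute continuity between ρ, norms and translated curves goes through this
comparison of increments. -/
theorem AbsContWrt.of_le {X Y : Type*} {d : X → X → ℝ} {d' : Y → Y → ℝ} {f : ℝ → X} {g : ℝ → Y}
    {a b : ℝ} (hf : AbsContWrt d f a b) (C : ℝ) (h0 : ∀ x y, 0 ≤ d' x y)
    (h : ∀ s ∈ uIcc a b, ∀ t ∈ uIcc a b, d' (g s) (g t) ≤ C * d (f s) (f t)) :
    AbsContWrt d' g a b := by
  have h1 := hf.const_mul C
  rw [mul_zero] at h1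
  refine squeeze_zero' (Eventually.of_forall fun F => Finset.sum_nonneg fun i _ => h0 _ _) ?_ h1
  have h2 : disjWithin a b ∈ totalLengthFilter ⊓ 𝓟 (disjWithin a b) :=
    mem_inf_of_right (mem_principal_self _)
  filter_upwards [h2] with F hF
  rw [Finset.mul_sum]
  exact Finset.sum_le_sum fun i hi => h _ (hF.1 i hi).1 _ (hF.1 i hi).2

variable {E : Type*} [NormedAddCommGroup E] [NormedSpace ℝ E]

theorem ae_differentiableAt_of_absolutelyContinuous [FiniteDimensional ℝ E] {f : ℝ → E} {a b : ℝ}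
    (hf : AbsolutelyContinuousOnInterval f a b) :
    ∀ᵐ t : ℝ, t ∈ uIcc a b → DifferentiableAt ℝ f t :=
  hf.boundedVariationOn.ae_differentiableAt_of_mem_uIcc

theorem _root_.AbsolutelyContinuousOnInterval.clm_comp {F : Type*} [NormedAddCommGroup F]
    [NormedSpace ℝ F] {f : ℝ → E} {a b : ℝ}
    (hf : AbsolutelyContinuousOnInterval f a b) (T : E →L[ℝ] F) :
    AbsolutelyContinuousOnInterval (fun t => T (f t)) a b := by
  have h : AbsContWrt dist f a b := (absContWrt_dist_iff f a b).2 hf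
  refine (absContWrt_dist_iff _ a b).1 (h.of_le ‖T‖ (fun _ _ => dist_nonneg) fun s _ t _ => ?_)
  rw [dist_eq_norm, dist_eq_norm, ← map_sub]
  exact T.le_opNorm _

theorem intervalIntegrable_deriv_of_absolutelyContinuous [FiniteDimensional ℝ E] {f : ℝ → E}
    {a b : ℝ} (hf : AbsolutelyContinuousOnInterval f a b) :
    IntervalIntegrable (deriv f) volume a b := by
  let B := Module.finBasis ℝ E
  let c : Fin (Module.finrank ℝ E) → E →L[ℝ] ℝ := fun i => (B.coord i).toContinuousLinearMap
  have h1 : ∀ i, IntervalIntegrable (fun t => deriv (fun s => c i (f s)) t • B i) volume a b :=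
    fun i => ⟨(hf.clm_comp (c i)).intervalIntegrable_deriv.1.smul_const (B i),
      (hf.clm_comp (c i)).intervalIntegrable_deriv.2.smul_const (B i)⟩
  have h2 : IntervalIntegrable (fun t => ∑ i, deriv (fun s => c i (f s)) t • B i) volume a b := by
    have := IntervalIntegrable.sum Finset.univ (fun i _ => h1 i)
    simpa [Finset.sum_fn] using this
  refine h2.congr_ae ?_
  rw [EventuallyEq, ae_restrict_iff' measurableSet_uIoc]
  filter_upwards [ae_differentiableAt_of_absolutelyContinuous hf] with t ht htm
  have hd := ht (uIoc_subset_uIcc htm)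
  have h3 : ∀ i, deriv (fun s => c i (f s)) t = c i (deriv f t) := fun i =>
    ((c i).hasFDerivAt.comp_hasDerivAt t hd.hasDerivAt).deriv
  simp only [h3]
  exact B.sum_repr (deriv f t)

/-- A functional of norm at most 1 that attains the norm of f(b) - f(a) reduces this to the scalar
fundamental theorem of calculus. -/
theorem norm_sub_le_integral_of_absolutelyContinuous {f : ℝ → E} {g : ℝ → ℝ} {a b : ℝ}
    (hab : a ≤ b) (hf : AbsolutelyContinuousOnInterval f a b)
    (hg : IntervalIntegrable g volume a b)
    (hd : ∀ᵐ t : ℝ, t ∈ Icc a b → DifferentiableAt ℝ f t ∧ ‖deriv f t‖ ≤ g t) :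
    ‖f b - f a‖ ≤ ∫ t in a..b, g t := by
  obtain ⟨T, hT, hTv⟩ := exists_dual_vector'' ℝ (f b - f a)
  have h1 := (hf.clm_comp T).integral_deriv_eq_sub
  have h2 : ‖f b - f a‖ = ∫ t in a..b, deriv (fun s => T (f s)) t := by
    rw [h1, ← map_sub, hTv]
    rfl
  rw [h2]
  refine intervalIntegral.integral_mono_ae_restrict hab (hf.clm_comp T).intervalIntegrable_deriv
    hg ?_
  rw [EventuallyLE, ae_restrict_iff' measurableSet_Icc]
  filter_upwards [hd] with t ht htm
  obtain ⟨h3, h4⟩ := ht htm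
  have h5 : deriv (fun s => T (f s)) t = T (deriv f t) :=
    (T.hasFDerivAt.comp_hasDerivAt t h3.hasDerivAt).deriv
  rw [h5]
  calc T (deriv f t) ≤ ‖T (deriv f t)‖ := Real.le_norm_self _
    _ ≤ ‖T‖ * ‖deriv f t‖ := T.le_opNorm _
    _ ≤ 1 * g t := mul_le_mul hT h4 (norm_nonneg _) zero_le_one
    _ = g t := one_mul _

/-- An absolutely continuous curve in a normed space is pointwise Lipschitz almost everywhere. -/
theorem ae_eventually_dist_le_of_absolutelyContinuous_normed {F : Type*} [NormedAddCommGroup F]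
    {f : ℝ → F} {a b : ℝ} (hf : AbsolutelyContinuousOnInterval f a b) :
    ∀ᵐ t : ℝ, t ∈ Ioo a b → ∃ C, ∀ᶠ s in 𝓝 t, dist (f t) (f s) ≤ C * |s - t| := by
  have hbv := hf.boundedVariationOn
  rcases le_or_gt b a with hab | hab
  · simp [Ioo_eq_empty_of_le hab]
  rw [uIcc_of_le hab.le] at hbv
  have hloc := hbv.locallyBoundedVariationOn
  -- The variation function dominates the increments of f and, being monotone, is differentiable
  -- almost everywhere; f itself need not be.
  have hmono : MonotoneOn (variationOnFromTo f (Icc a b) a) (Icc a b) :=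
    variationOnFromTo.monotoneOn hloc (left_mem_Icc.2 hab.le)
  have hle : ∀ s ∈ Icc a b, ∀ t ∈ Icc a b, dist (f s) (f t) ≤
      |variationOnFromTo f (Icc a b) a t - variationOnFromTo f (Icc a b) a s| := by
    intro s hs t ht
    rw [variationOnFromTo.sub_right hloc (left_mem_Icc.2 hab.le) ht hs]
    have key : ∀ s ∈ Icc a b, ∀ t ∈ Icc a b, s ≤ t →
        dist (f s) (f t) ≤ variationOnFromTo f (Icc a b) s t := by
      intro s hs t ht hst
      rw [variationOnFromTo.eq_of_le _ _ hst, dist_edist]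
      exact ENNReal.toReal_mono (hloc s t hs ht)
        (eVariationOn.edist_le f ⟨hs, le_rfl, hst⟩ ⟨ht, hst, le_rfl⟩)
    rcases le_total s t with h | h
    · exact (key s hs t ht h).trans (le_abs_self _)
    · rw [variationOnFromTo.eq_neg_swap, abs_neg, dist_comm]
      exact (key t ht s hs h).trans (le_abs_self _)
  filter_upwards [hmono.ae_differentiableWithinAt_of_mem] with t ht htm
  have htI := Ioo_subset_Icc_self htm
  have hd := (ht htI).differentiableAt (Icc_mem_nhds htm.1 htm.2)
  obtain ⟨C, hC⟩ := hd.hasFDerivAt.isBigO_sub.bound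
  refine ⟨C, ?_⟩
  filter_upwards [hC, Icc_mem_nhds htm.1 htm.2] with s hs hsI
  exact (hle t htI s hsI).trans (by simpa using hs)

/-- The Kuratowski embedding is isometric and reduces the claim to normed spaces; separability is
needed for it. -/
theorem ae_eventually_dist_le_of_absolutelyContinuous {α : Type*} [MetricSpace α]
    [TopologicalSpace.SeparableSpace α] {f : ℝ → α} {a b : ℝ}
    (hf : AbsolutelyContinuousOnInterval f a b) :
    ∀ᵐ t : ℝ, t ∈ Ioo a b → ∃ C, ∀ᶠ s in 𝓝 t, dist (f t) (f s) ≤ C * |s - t| := by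
  obtain ⟨φ, hφ⟩ := KuratowskiEmbedding.exists_isometric_embedding α
  have h : AbsContWrt dist f a b := (absContWrt_dist_iff f a b).2 hf
  have h1 : AbsolutelyContinuousOnInterval (fun t => φ (f t)) a b := by
    refine (absContWrt_dist_iff _ a b).1 (h.of_le 1 (fun _ _ => dist_nonneg) fun s _ t _ => ?_)
    rw [hφ.dist_eq, one_mul]
  simpa only [hφ.dist_eq] using ae_eventually_dist_le_of_absolutelyContinuous_normed h1

end AbsolutelyContinuous

/-! ### Horizontal curves: bounds by induction on the degree -/

section Grading

variable {E : Type*} [NormedAddCommGroup E] [NormedSpace ℝ E] {υ : ℕ}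
  {br : E →L[ℝ] E →L[ℝ] E} {π : ℕ → E →L[ℝ] E} (hπ : IsGrading υ br π)
include hπ

namespace IsGrading

theorem exists_norm_proj_bracket_pow_le (i : ℕ) {a b : ℝ} (ha : 0 ≤ a) (hb : 0 ≤ b) (k : ℕ) :
    ∃ K ≥ 0, ∀ (X Z : E) (L H : ℝ), 0 ≤ L → 0 ≤ H → (∀ p < i, ‖π p X‖ ≤ a * L ^ p) →
      (∀ q < i, ‖π q Z‖ ≤ b * L ^ (q - 1) * H) →
      ∀ j ≤ i, ‖π j ((br X ^ (k + 1)) Z)‖ ≤ K * L ^ (j - 1) * H := by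
  induction k with
  | zero =>
    refine ⟨(i + 1) * ‖br‖ * a * b, by positivity, fun X Z L H hL hH hX hZ j hj => ?_⟩
    simpa using hπ.norm_proj_bracket_le ha hb hL hH hX hZ j hj
  | succ k ih =>
    obtain ⟨K, hK, h⟩ := ih
    refine ⟨(i + 1) * ‖br‖ * a * K, by positivity, fun X Z L H hL hH hX hZ j hj => ?_⟩
    rw [pow_succ', mul_apply_eq_comp]
    exact hπ.norm_proj_bracket_le ha hK hL hH hX (fun q hq => h X Z L H hL hH hX hZ q hq.le) j hj

/-- For a horizontal velocity, each component is controlled by the components of lower degree. -/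
theorem exists_norm_proj_le_of_horizontal (i : ℕ) {a : ℝ} (ha : 0 ≤ a) :
    ∃ K ≥ 0, ∀ (X Z : E) (L : ℝ), 0 ≤ L →
      (∀ j, 2 ≤ j → π j (negExpPrimitive υ (br X) 1 Z) = 0) →
      (∀ p < i, ‖π p X‖ ≤ a * L ^ p) → (∀ q < i, ‖π q Z‖ ≤ a * L ^ (q - 1) * ‖π 1 Z‖) →
      ‖π i Z‖ ≤ K * L ^ (i - 1) * ‖π 1 Z‖ := by
  rcases Nat.eq_zero_or_pos i with rfl | hi
  · exact ⟨0, le_rfl, fun X Z L _ _ _ _ => by simp [hπ.zero]⟩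
  obtain rfl | hi : i = 1 ∨ 2 ≤ i := by omega
  · exact ⟨1, zero_le_one, fun X Z L _ _ _ _ => by simp⟩
  choose K hK h using fun k => hπ.exists_norm_proj_bracket_pow_le i ha ha k
  refine ⟨∑ n ∈ Finset.Icc 2 υ, ‖(-1 : ℝ) ^ n / (n.factorial : ℝ)‖ * K (n - 2),
    Finset.sum_nonneg fun n _ => mul_nonneg (norm_nonneg _) (hK _), fun X Z L hL hF hX hZ => ?_⟩
  have h1 := hF i hi
  rw [hπ.negExpPrimitive_apply, map_sub, sub_eq_zero, map_sum] at h1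
  rw [h1, Finset.sum_mul, Finset.sum_mul]
  refine norm_sum_le_of_le _ fun n hn => ?_
  have h2 := h (n - 2) X Z L ‖π 1 Z‖ hL (norm_nonneg _) hX hZ i le_rfl
  rw [show n - 2 + 1 = n - 1 by have := Finset.mem_Icc.1 hn; omega] at h2
  rw [map_smul, norm_smul, mul_assoc, mul_assoc]
  rw [mul_assoc] at h2
  gcongr

variable [FiniteDimensional ℝ E]

/-- Positions of size L^j and velocities of size L^(j-1)‖π 1 γ'‖ in degrees below i bound the
velocity in degree i by horizontality; integrating from η(a) = 0 gains one factor L for the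
position. -/
theorem exists_norm_proj_curve_le_aux (i : ℕ) :
    ∃ K ≥ 0, ∀ (η : ℝ → E) (a b : ℝ), a ≤ b → AbsolutelyContinuousOnInterval η a b → η a = 0 →
      (∀ᵐ t : ℝ, t ∈ Icc a b → ∀ j, 2 ≤ j →
        π j (negExpPrimitive υ (br (η t)) 1 (deriv η t)) = 0) →
      ∀ j < i, (∀ t ∈ Icc a b, ‖π j (η t)‖ ≤ K * (∫ s in a..b, ‖π 1 (deriv η s)‖) ^ j) ∧
        ∀ᵐ t : ℝ, t ∈ Icc a b → ‖π j (deriv η t)‖ ≤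
          K * (∫ s in a..b, ‖π 1 (deriv η s)‖) ^ (j - 1) * ‖π 1 (deriv η t)‖ := by
  induction i with
  | zero => exact ⟨0, le_rfl, fun _ _ _ _ _ _ _ j hj => absurd hj (Nat.not_lt_zero j)⟩
  | succ i ih =>
    obtain ⟨K, hK, ih⟩ := ih
    obtain ⟨K', hK', hstep⟩ := hπ.exists_norm_proj_le_of_horizontal i hK
    refine ⟨max K K', le_max_of_le_left hK, fun η a b hab hη h0 hF => ?_⟩
    have ih := ih η a b hab hη h0 hF
    set L := ∫ s in a..b, ‖π 1 (deriv η s)‖ with hL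
    have hLnn : 0 ≤ L := intervalIntegral.integral_nonneg hab fun _ _ => norm_nonneg _
    have hint : IntervalIntegrable (fun s => ‖π 1 (deriv η s)‖) volume a b := by
      have h1 := intervalIntegrable_deriv_of_absolutelyContinuous hη
      exact ⟨((π 1).integrable_comp h1.1).norm, ((π 1).integrable_comp h1.2).norm⟩
    have hder : ∀ᵐ t : ℝ, t ∈ Icc a b → ‖π i (deriv η t)‖ ≤
        K' * L ^ (i - 1) * ‖π 1 (deriv η t)‖ := by
      have h1 : ∀ᵐ t : ℝ, ∀ j < i, t ∈ Icc a b → ‖π j (deriv η t)‖ ≤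
          K * L ^ (j - 1) * ‖π 1 (deriv η t)‖ := by
        rw [ae_all_iff]
        intro j
        by_cases hj : j < i
        · filter_upwards [(ih j hj).2] with t ht _ using ht
        · exact Eventually.of_forall fun t h => absurd h hj
      filter_upwards [h1, hF] with t ht hFt htm
      exact hstep (η t) (deriv η t) L hLnn (hFt htm) (fun p hp => (ih p hp).1 t htm)
        (fun q hq => ht q hq htm)
    have hval : ∀ t ∈ Icc a b, ‖π i (η t)‖ ≤ K' * L ^ i := by
      intro t ht
      rcases Nat.eq_zero_or_pos i with rfl | hi
      · simpa [hπ.zero] using hK'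
      have hsub : uIcc a t ⊆ uIcc a b := by
        rw [uIcc_of_le ht.1, uIcc_of_le hab]
        exact Icc_subset_Icc_right ht.2
      have hηt := hη.mono hsub
      have hintt : IntervalIntegrable (fun s => ‖π 1 (deriv η s)‖) volume a t :=
        hint.mono_set hsub
      have h1 := norm_sub_le_integral_of_absolutelyContinuous ht.1 (hηt.clm_comp (π i))
        (hintt.const_mul (K' * L ^ (i - 1))) (by
          filter_upwards [hder, ae_differentiableAt_of_absolutelyContinuous hη] with s hs hd hsm
          have hsb : s ∈ Icc a b := Icc_subset_Icc_right ht.2 hsm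
          have h2 := (π i).hasFDerivAt.comp_hasDerivAt s
            (hd (by rwa [uIcc_of_le hab])).hasDerivAt
          refine ⟨h2.differentiableAt, ?_⟩
          have h3 : deriv (fun s => π i (η s)) s = π i (deriv η s) := h2.deriv
          rw [h3]
          exact hs hsb)
      rw [h0, _root_.map_zero, sub_zero, intervalIntegral.integral_const_mul] at h1
      have h2 : ∫ s in a..t, ‖π 1 (deriv η s)‖ ≤ L :=
        intervalIntegral.integral_mono_interval le_rfl ht.1 ht.2
          (Eventually.of_forall fun _ => norm_nonneg _) hint
      calc ‖π i (η t)‖ ≤ K' * L ^ (i - 1) * ∫ s in a..t, ‖π 1 (deriv η s)‖ := h1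
        _ ≤ K' * L ^ (i - 1) * L := by gcongr
        _ = K' * L ^ i := by rw [mul_assoc, ← pow_succ, Nat.sub_add_cancel hi]
    intro j hj
    rcases Nat.lt_succ_iff_lt_or_eq.1 hj with hj | rfl
    · refine ⟨fun t ht => ((ih j hj).1 t ht).trans (by gcongr; exact le_max_left _ _), ?_⟩
      filter_upwards [(ih j hj).2] with t ht htm
      exact (ht htm).trans (by gcongr; exact le_max_left _ _)
    · refine ⟨fun t ht => (hval t ht).trans (by gcongr; exact le_max_right _ _), ?_⟩
      filter_upwards [hder] with t ht htm
      exact (ht htm).trans (by gcongr; exact le_max_right _ _)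

/-- The components of a horizontal curve starting at zero are bounded by powers of its length. -/
theorem exists_norm_proj_curve_le :
    ∃ K ≥ 0, ∀ (η : ℝ → E) (a b : ℝ), a ≤ b → AbsolutelyContinuousOnInterval η a b → η a = 0 →
      (∀ᵐ t : ℝ, t ∈ Icc a b → ∀ j, 2 ≤ j →
        π j (negExpPrimitive υ (br (η t)) 1 (deriv η t)) = 0) →
      ∀ j ∈ Finset.Icc 1 υ, ‖π j (η b)‖ ≤ K * (∫ s in a..b, ‖π 1 (deriv η s)‖) ^ j := by
  obtain ⟨K, hK, h⟩ := hπ.exists_norm_proj_curve_le_aux (υ + 1)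
  refine ⟨K, hK, fun η a b hab hη h0 hF j hj => ?_⟩
  exact (h η a b hab hη h0 hF j (Nat.lt_succ_of_le (Finset.mem_Icc.1 hj).2)).1 b
    (right_mem_Icc.2 hab)

end IsGrading

end Grading

/-- A curve that is absolutely continuous for a continuous distance on a separable space is
almost everywhere pointwise Lipschitz. -/
theorem AbsContWrt.ae_eventually_le {α : Type*} [TopologicalSpace α]
    [TopologicalSpace.SeparableSpace α] {ρ : α → α → ℝ} {f : ℝ → α} {a b : ℝ}
    (hf : AbsContWrt ρ f a b) (hself : ∀ x, ρ x x = 0) (heq : ∀ x y, ρ x y = 0 → x = y)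
    (hsymm : ∀ x y, ρ x y = ρ y x) (htri : ∀ x y z, ρ x z ≤ ρ x y + ρ y z)
    (hc : Continuous fun p : α × α => ρ p.1 p.2) :
    ∀ᵐ t : ℝ, t ∈ Ioo a b → ∃ M, ∀ᶠ s in 𝓝 t, ρ (f t) (f s) ≤ M * |s - t| := by
  obtain ⟨S, hS, hSd⟩ := TopologicalSpace.exists_countable_dense α
  have hne : ∀ x, ∀ r > 0, ∃ y ∈ S, ρ y x < r := by
    intro x r hr
    have ho : IsOpen {y | ρ y x < r} :=
      isOpen_lt (hc.comp (continuous_id.prodMk continuous_const)) continuous_const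
    obtain ⟨y, hy, hyS⟩ := hSd.inter_open_nonempty _ ho ⟨x, by simpa [hself] using hr⟩
    exact ⟨y, hyS, hy⟩
  -- The topology defined by ρ may differ from the given one. Continuity of ρ carries the countable
  -- dense set over.
  let m : MetricSpace α :=
    { dist := ρ, dist_self := hself, dist_comm := hsymm, dist_triangle := htri
      eq_of_dist_eq_zero := heq _ _ }
  have hsep : @TopologicalSpace.SeparableSpace α
      m.toPseudoMetricSpace.toUniformSpace.toTopologicalSpace := by
    refine @TopologicalSpace.SeparableSpace.mk α m.toPseudoMetricSpace.toUniformSpace.toTopologicalSpace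
      ⟨S, hS, ?_⟩
    refine (@Metric.dense_iff α m.toPseudoMetricSpace S).2 fun x r hr => ?_
    obtain ⟨y, hyS, hy⟩ := hne x r hr
    exact ⟨y, hy, hyS⟩
  exact @ae_eventually_dist_le_of_absolutelyContinuous α m hsep f a b hf

/-! ### Left translations and the two implications for curves -/

section Curves

variable {E G : Type*} [NormedAddCommGroup E] [NormedSpace ℝ E] [FiniteDimensional ℝ E]
  [TopologicalSpace G] [Group G] [IsTopologicalGroup G] [T2Space G]
  {κ : OpenPartialHomeomorph G E} {e : E → G} {υ : ℕ} {π : ℕ → E →L[ℝ] E}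

namespace IsExponential

variable (he : IsExponential κ e) (hκ : IsIdentityChart κ) (hπ : IsGrading υ (chartBracket κ) π)
  {Φ : E ≃ₜ G} (hΦ : ⇑Φ = e)
include he hκ hπ hΦ

/-- Left translations by elements of a bounded set are uniformly Lipschitz on bounded sets. -/
theorem exists_leftTranslation_lipschitz (R : ℝ) : ∃ C ≥ 0, ∀ A X Y : E, ‖A‖ ≤ R → ‖X‖ ≤ R →
    ‖Y‖ ≤ R → ‖Φ.symm (e A * e X) - Φ.symm (e A * e Y)‖ ≤ C * ‖X - Y‖ := by
  have hcomplete : CompleteSpace E := FiniteDimensional.complete ℝ E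
  have hproper : ProperSpace E := FiniteDimensional.proper ℝ E
  have hc := he.continuous hκ hπ.bracket_pow_eq_zero
  have hF : Continuous fun X : E => negExpPrimitive υ (chartBracket κ X) 1 :=
    (continuous_negExpPrimitive υ 1).comp (chartBracket κ).continuous
  have hℓ : Continuous fun p : E × E => Φ.symm (e p.1 * e p.2) :=
    Φ.symm.continuous.comp ((hc.comp continuous_fst).mul (hc.comp continuous_snd))
  -- The derivative F(AX)⁻¹F(X) of the translation is jointly continuous, hence bounded on the
  -- product of balls. `Ring.inverse` makes it an expression defined everywhere.
  have hD : Continuous fun p : E × E =>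
      Ring.inverse (negExpPrimitive υ (chartBracket κ (Φ.symm (e p.1 * e p.2))) 1) *
        negExpPrimitive υ (chartBracket κ p.2) 1 := by
    refine Continuous.mul ?_ (hF.comp continuous_snd)
    rw [continuous_iff_continuousAt]
    intro p
    obtain ⟨T, hT⟩ := hπ.exists_equiv (Φ.symm (e p.1 * e p.2))
    have h1 : ContinuousAt Ring.inverse
        (negExpPrimitive υ (chartBracket κ (Φ.symm (e p.1 * e p.2))) 1) := by
      rw [← hT]
      exact NormedRing.inverse_continuousAt (ContinuousLinearEquiv.toUnit T)
    exact ContinuousAt.comp (f := fun p : E × E =>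
      negExpPrimitive υ (chartBracket κ (Φ.symm (e p.1 * e p.2))) 1) h1
      (hF.comp hℓ).continuousAt
  obtain ⟨C, hC⟩ := ((isCompact_closedBall (0 : E) R).prod
    (isCompact_closedBall (0 : E) R)).exists_bound_of_continuousOn hD.continuousOn
  refine ⟨max C 0, le_max_right _ _, fun A X Y hA hX hY => ?_⟩
  refine (convex_closedBall (0 : E) R).norm_image_sub_le_of_norm_hasFDerivWithin_le
    (f := fun Y => Φ.symm (e A * e Y))
    (f' := fun X => Ring.inverse (negExpPrimitive υ (chartBracket κ (Φ.symm (e A * e X))) 1) *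
        negExpPrimitive υ (chartBracket κ X) 1)
    (fun Z _ => ?_) (fun Z hZ => ?_) (mem_closedBall_zero_iff.2 hY) (mem_closedBall_zero_iff.2 hX)
  · obtain ⟨T, hT⟩ := hπ.exists_equiv (Φ.symm (e A * e Z))
    have h1 := he.hasFDerivAt_leftTranslation hκ hπ hΦ A Z T hT
    have h2 : Ring.inverse (negExpPrimitive υ (chartBracket κ (Φ.symm (e A * e Z))) 1) =
        (T.symm : E →L[ℝ] E) := by
      rw [← hT]
      exact Ring.inverse_unit (ContinuousLinearEquiv.toUnit T)
    rw [h2]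
    exact h1.hasFDerivWithinAt
  · exact (hC (A, Z) ⟨mem_closedBall_zero_iff.2 hA, hZ⟩).trans (le_max_left _ _)

/-- Left translations preserve the left logarithmic derivative of curves. -/
theorem negExpPrimitive_deriv_leftTranslation (A : E) {γ : ℝ → E} {t : ℝ}
    (hγ : DifferentiableAt ℝ γ t) :
    DifferentiableAt ℝ (fun s => Φ.symm (e A * e (γ s))) t ∧
    negExpPrimitive υ (chartBracket κ (Φ.symm (e A * e (γ t)))) 1
      (deriv (fun s => Φ.symm (e A * e (γ s))) t) =
    negExpPrimitive υ (chartBracket κ (γ t)) 1 (deriv γ t) := by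
  obtain ⟨T, hT⟩ := hπ.exists_equiv (Φ.symm (e A * e (γ t)))
  have h1 := (he.hasFDerivAt_leftTranslation hκ hπ hΦ A (γ t) T hT).comp_hasDerivAt t
    hγ.hasDerivAt
  refine ⟨h1.differentiableAt, ?_⟩
  have h2 : deriv (fun s => Φ.symm (e A * e (γ s))) t = _ := h1.deriv
  rw [h2, ← hT]
  simp

variable {ρ : G → G → ℝ} (hρ : IsHomDist π υ e ρ)
include hρ

/-- The distance between points of a horizontal curve is bounded by the length of the curve. -/
theorem exists_dist_le_integral : ∃ C > 0, ∀ (γ : ℝ → E) (a b : ℝ), a ≤ b →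
    AbsolutelyContinuousOnInterval γ a b →
    (∀ᵐ t : ℝ, t ∈ Icc a b → ∀ j, 2 ≤ j →
      π j (negExpPrimitive υ (chartBracket κ (γ t)) 1 (deriv γ t)) = 0) →
    ρ (e (γ a)) (e (γ b)) ≤ C * ∫ t in a..b, ‖π 1 (deriv γ t)‖ := by
  have hc := he.continuous hκ hπ.bracket_pow_eq_zero
  obtain ⟨K, hK, hcurve⟩ := hπ.exists_norm_proj_curve_le
  obtain ⟨C, hC, hle⟩ := hρ.exists_le_of_norm_proj_le hπ hc he.map_zero K
  refine ⟨C, hC, fun γ a b hab hγ hF => ?_⟩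
  obtain ⟨R, hR⟩ := hγ.exists_bound
  have hγa : ‖-γ a‖ ≤ R := by rw [norm_neg]; exact hR a left_mem_uIcc
  obtain ⟨C', hC', hlip⟩ := he.exists_leftTranslation_lipschitz hκ hπ hΦ R
  -- The curve translated to start at 0. It has the same F(η)η', and since F preserves degree one
  -- components, the same horizontal length.
  let η : ℝ → E := fun s => Φ.symm (e (-γ a) * e (γ s))
  have heΦ : ∀ g, e (Φ.symm g) = g := fun g => by rw [← hΦ, Φ.apply_symm_apply]
  have heη : ∀ s, e (η s) = e (-γ a) * e (γ s) := fun s => heΦ _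
  have hη : AbsolutelyContinuousOnInterval η a b := by
    have h : AbsContWrt dist γ a b := (absContWrt_dist_iff γ a b).2 hγ
    refine (absContWrt_dist_iff _ a b).1 (h.of_le C' (fun _ _ => dist_nonneg)
      fun s hs t ht => ?_)
    rw [dist_eq_norm, dist_eq_norm]
    exact hlip _ _ _ hγa (hR s hs) (hR t ht)
  have hη0 : η a = 0 := by
    rw [← Φ.injective.eq_iff, hΦ, heη, he.map_neg, inv_mul_cancel, he.map_zero]
  have hdiff := ae_differentiableAt_of_absolutelyContinuous hγ
  rw [uIcc_of_le hab] at hdiff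
  have hηF : ∀ᵐ t : ℝ, t ∈ Icc a b → ∀ j, 2 ≤ j →
      π j (negExpPrimitive υ (chartBracket κ (η t)) 1 (deriv η t)) = 0 := by
    filter_upwards [hF, hdiff] with t ht hd htm j hj
    rw [(he.negExpPrimitive_deriv_leftTranslation hκ hπ hΦ (-γ a) (hd htm)).2]
    exact ht htm j hj
  have hint : ∫ t in a..b, ‖π 1 (deriv η t)‖ = ∫ t in a..b, ‖π 1 (deriv γ t)‖ := by
    refine intervalIntegral.integral_congr_ae ?_
    filter_upwards [hdiff] with t hd htm
    rw [uIoc_of_le hab] at htm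
    have h1 := (he.negExpPrimitive_deriv_leftTranslation hκ hπ hΦ (-γ a)
      (hd (Ioc_subset_Icc_self htm))).2
    rw [← hπ.proj_one_negExpPrimitive (γ t) (deriv γ t), ← h1, hπ.proj_one_negExpPrimitive]
  have h1 := hle (η b) _ (intervalIntegral.integral_nonneg hab fun _ _ => norm_nonneg _)
    (hcurve η a b hab hη hη0 hηF)
  rwa [hint, heη, he.map_neg, ← hρ.eq_one_inv_mul] at h1

/-- A curve that is absolutely continuous for the homogeneous distance has absolutely continuous
exponential coordinates and is horizontal. -/
theorem absolutelyContinuous_and_horizontal {γ : ℝ → E} {a b : ℝ} (hab : a ≤ b)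
    (hγ : AbsContWrt ρ (fun t => e (γ t)) a b) :
    AbsolutelyContinuousOnInterval γ a b ∧ ∀ᵐ t : ℝ, t ∈ Icc a b → ∀ j, 2 ≤ j →
      π j (negExpPrimitive υ (chartBracket κ (γ t)) 1 (deriv γ t)) = 0 := by
  have hcomplete : CompleteSpace E := FiniteDimensional.complete ℝ E
  have hc := he.continuous hκ hπ.bracket_pow_eq_zero
  have hinj : Function.Injective e := hΦ ▸ Φ.injective
  obtain ⟨C, hC, hle⟩ := hρ.exists_norm_proj_le hπ hc he.map_zero hinj
  -- The function ρ(1, Γ(t)) is absolutely continuous by the triangle inequality, hence bounded.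
  -- Below, 2D bounds the distance between two points of Γ.
  obtain ⟨D, hD⟩ : ∃ D, ∀ t ∈ uIcc a b, ‖ρ 1 (e (γ t))‖ ≤ D := by
    have h1 : AbsContWrt dist (fun t => ρ 1 (e (γ t))) a b := by
      refine hγ.of_le 1 (fun _ _ => dist_nonneg) fun s _ t _ => ?_
      rw [Real.dist_eq, one_mul, abs_sub_le_iff]
      have h1 := hρ.triangle 1 (e (γ s)) (e (γ t))
      have h2 := hρ.triangle 1 (e (γ t)) (e (γ s))
      rw [hρ.symm (e (γ t))] at h2
      constructor <;> linarith
    exact ((absContWrt_dist_iff _ a b).1 h1).exists_bound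
  have hD' : ∀ t ∈ uIcc a b, ρ 1 (e (γ t)) ≤ D := fun t ht => (Real.le_norm_self _).trans (hD t ht)
  have hD0 : 0 ≤ D := (norm_nonneg _).trans (hD a left_mem_uIcc)
  let R : ℝ := ∑ j ∈ Finset.Icc 1 υ, C * (2 * D) ^ j
  have hbound : ∀ X : E, ρ 1 (e X) ≤ 2 * D → ‖X‖ ≤ R := by
    intro X hX
    refine (hπ.norm_le_sum X).trans (Finset.sum_le_sum fun j _ => (hle X j).trans ?_)
    have := hρ.nonneg 1 (e X)
    gcongr
  have hR0 : 0 ≤ R := Finset.sum_nonneg fun j _ => by positivity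
  let K : ℝ := ∑ j ∈ Finset.Icc 1 υ, C * (2 * D) ^ (j - 1)
  have hbound' : ∀ X : E, ρ 1 (e X) ≤ 2 * D → ‖X‖ ≤ K * ρ 1 (e X) := by
    intro X hX
    have h0 := hρ.nonneg 1 (e X)
    rw [Finset.sum_mul]
    refine (hπ.norm_le_sum X).trans (Finset.sum_le_sum fun j hj => (hle X j).trans ?_)
    have hj : j = (j - 1) + 1 := by have := Finset.mem_Icc.1 hj; omega
    calc C * ρ 1 (e X) ^ j = C * ρ 1 (e X) ^ (j - 1) * ρ 1 (e X) := by
          rw [mul_assoc, ← pow_succ, ← hj]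
      _ ≤ C * (2 * D) ^ (j - 1) * ρ 1 (e X) := by gcongr
  have hγR : ∀ t ∈ uIcc a b, ‖γ t‖ ≤ R := fun t ht => hbound _ (by linarith [hD' t ht])
  have heΦ : ∀ g, e (Φ.symm g) = g := fun g => by rw [← hΦ, Φ.apply_symm_apply]
  have heη : ∀ s t, e (Φ.symm (e (-γ s) * e (γ t))) = e (-γ s) * e (γ t) := fun s t => heΦ _
  have hρη : ∀ s t, ρ 1 (e (Φ.symm (e (-γ s) * e (γ t)))) = ρ (e (γ s)) (e (γ t)) := by
    intro s t
    rw [heη, he.map_neg, ← hρ.eq_one_inv_mul]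
  obtain ⟨C', hC', hlip⟩ := he.exists_leftTranslation_lipschitz hκ hπ hΦ R
  have hac : AbsolutelyContinuousOnInterval γ a b := by
    refine (absContWrt_dist_iff _ a b).1 (hγ.of_le (C' * K) (fun _ _ => dist_nonneg)
      fun s hs t ht => ?_)
    have hst : ρ 1 (e (Φ.symm (e (-γ s) * e (γ t)))) ≤ 2 * D := by
      have h1 := hρ.triangle (e (γ s)) 1 (e (γ t))
      rw [hρ.symm _ 1] at h1
      rw [hρη]
      linarith [hD' s hs, hD' t ht]
    -- Translation by γ(s) sends 0 to γ(s) and the increment log(Γ(s)⁻¹Γ(t)) to γ(t); the increment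
    -- is bounded linearly by ρ.
    have h1 := hlip (γ s) (Φ.symm (e (-γ s) * e (γ t))) 0 (hγR s hs) (hbound _ hst)
      (by simpa using hR0)
    have h2 : Φ.symm (e (γ s) * e (Φ.symm (e (-γ s) * e (γ t)))) = γ t := by
      rw [heη, he.map_neg, mul_inv_cancel_left, ← hΦ, Φ.symm_apply_apply]
    have h3 : Φ.symm (e (γ s) * e 0) = γ s := by
      rw [he.map_zero, mul_one, ← hΦ, Φ.symm_apply_apply]
    rw [h2, h3, sub_zero] at h1
    rw [dist_comm, dist_eq_norm]
    calc ‖γ t - γ s‖ ≤ C' * ‖Φ.symm (e (-γ s) * e (γ t))‖ := h1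
      _ ≤ C' * (K * ρ (e (γ s)) (e (γ t))) := by
        have := hbound' _ hst
        rw [hρη] at this
        gcongr
      _ = C' * K * ρ (e (γ s)) (e (γ t)) := by ring
  refine ⟨hac, ?_⟩
  have hlipae : ∀ᵐ t : ℝ, t ∈ Ioo a b → ∃ M, ∀ᶠ s in 𝓝 t,
      ρ (e (γ t)) (e (γ s)) ≤ M * |s - t| := by
    have hsep : TopologicalSpace.SeparableSpace G := Φ.surjective.denseRange.separableSpace Φ.continuous
    exact hγ.ae_eventually_le hρ.self (fun x y => (hρ.eq_zero_iff x y).1) hρ.symm hρ.triangle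
      hρ.continuous
  have hdiff := ae_differentiableAt_of_absolutelyContinuous hac
  have ha : ∀ᵐ t : ℝ, t ≠ a := by simp [ae_iff, measure_singleton]
  have hb : ∀ᵐ t : ℝ, t ≠ b := by simp [ae_iff, measure_singleton]
  filter_upwards [hlipae, hdiff, ha, hb] with t hl hd hta htb htm j hj
  have hd := hd (by rwa [uIcc_of_le hab])
  obtain ⟨M, hM⟩ := hl ⟨lt_of_le_of_ne htm.1 hta.symm, lt_of_le_of_ne htm.2 htb⟩
  obtain ⟨h1, h2⟩ := he.negExpPrimitive_deriv_leftTranslation hκ hπ hΦ (-γ t) hd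
  have h3 : Φ.symm (e (-γ t) * e (γ t)) = 0 := by
    rw [← Φ.injective.eq_iff, hΦ, heη, he.map_neg, inv_mul_cancel, he.map_zero]
  -- The translated curve passes through 0 at time t, where F is the identity, so its plain
  -- derivative there is F(γ)γ'.
  have h4 : ∀ Z : E, negExpPrimitive υ (chartBracket κ 0) 1 Z = Z := by
    intro Z
    rw [hπ.negExpPrimitive_apply, Finset.sum_eq_zero, sub_zero]
    intro n hn
    rw [_root_.map_zero, zero_pow (by have := Finset.mem_Icc.1 hn; omega)]
    simp
  rw [h3, h4] at h2
  rw [← h2]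
  have h5 := (π j).hasFDerivAt.comp_hasDerivAt t h1.hasDerivAt
  refine h5.unique ?_
  have h6 : (fun s => π j (Φ.symm (e (-γ t) * e (γ s)))) =O[𝓝 t] fun s => ‖s - t‖ ^ j := by
    refine Asymptotics.IsBigO.of_bound (C * M ^ j) ?_
    filter_upwards [hM] with s hs
    refine (hle _ j).trans ?_
    rw [hρη, norm_pow, norm_norm, mul_assoc, ← mul_pow]
    have := hρ.nonneg (e (γ t)) (e (γ s))
    exact mul_le_mul_of_nonneg_left (pow_le_pow_left₀ this hs j) hC.le
  -- A function that is O(|s - t|^j) with j ≥ 2 has zero derivative at t.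
  exact (h6.hasFDerivAt (by omega)).hasDerivAt.congr_deriv (by simp)

end IsExponential

end Curves

/-! ### Independence of the norm -/

section Norms

variable {E : Type*} [NormedAddCommGroup E] [NormedSpace ℝ E] [FiniteDimensional ℝ E]
  (N : Seminorm ℝ E)

theorem exists_seminorm_le_norm : ∃ C > 0, ∀ X, N X ≤ C * ‖X‖ := by
  let B := Module.finBasis ℝ E
  let c : Fin (Module.finrank ℝ E) → E →L[ℝ] ℝ := fun i => (B.coord i).toContinuousLinearMap
  refine ⟨∑ i, ‖c i‖ * N (B i) + 1, by positivity, fun X => ?_⟩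
  have h1 : N X ≤ ∑ i, N (c i X • B i) := by
    conv_lhs => rw [← B.sum_repr X]
    exact Finset.le_sum_of_subadditive N (map_zero N).le (map_add_le_add N) _ _
  refine h1.trans ?_
  rw [add_mul, one_mul, Finset.sum_mul]
  refine le_add_of_le_of_nonneg (Finset.sum_le_sum fun i _ => ?_) (norm_nonneg _)
  rw [map_smul_eq_mul, mul_right_comm]
  exact mul_le_mul_of_nonneg_right ((c i).le_opNorm X) (apply_nonneg N _)

theorem continuous_seminorm : Continuous N := by
  obtain ⟨C, hC, h⟩ := exists_seminorm_le_norm N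
  refine Seminorm.continuous_of_le (q := C.toNNReal • normSeminorm ℝ E) ?_ fun X => ?_
  · exact (continuous_norm (E := E)).const_smul C.toNNReal
  · simpa [NNReal.smul_def, hC.le] using h X

theorem exists_norm_le_seminorm (hN : ∀ X, N X = 0 → X = 0) : ∃ C > 0, ∀ X, ‖X‖ ≤ C * N X := by
  have hproper : ProperSpace E := FiniteDimensional.proper ℝ E
  rcases (Metric.sphere (0 : E) 1).eq_empty_or_nonempty with h | h
  · refine ⟨1, one_pos, fun X => ?_⟩
    rcases eq_or_ne X 0 with rfl | hX
    · simp
    · have : ‖X‖⁻¹ • X ∈ Metric.sphere (0 : E) 1 := by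
        simp [norm_smul, inv_mul_cancel₀ (norm_ne_zero_iff.2 hX)]
      simp [h] at this
  obtain ⟨Y, hY, hmin⟩ := (isCompact_sphere (0 : E) 1).exists_isMinOn h
    (continuous_seminorm N).continuousOn
  have hpos : 0 < N Y := lt_of_le_of_ne (apply_nonneg N Y) fun h0 => by
    rw [hN Y h0.symm] at hY
    simp at hY
  refine ⟨(N Y)⁻¹, inv_pos.2 hpos, fun X => ?_⟩
  rcases eq_or_ne X 0 with rfl | hX
  · simp
  have h1 : N Y ≤ N (‖X‖⁻¹ • X) := hmin (by
    simp [norm_smul, inv_mul_cancel₀ (norm_ne_zero_iff.2 hX)])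
  rw [map_smul_eq_mul, norm_inv, norm_norm, le_inv_mul_iff₀ (norm_pos_iff.2 hX)] at h1
  rwa [le_inv_mul_iff₀ hpos, mul_comm]

theorem absContWrt_seminorm_iff (hN : ∀ X, N X = 0 → X = 0) (γ : ℝ → E) (a b : ℝ) :
    AbsContWrt (fun X Y => N (X - Y)) γ a b ↔ AbsolutelyContinuousOnInterval γ a b := by
  rw [← absContWrt_dist_iff]
  obtain ⟨C, -, hC⟩ := exists_seminorm_le_norm N
  obtain ⟨C', -, hC'⟩ := exists_norm_le_seminorm N hN
  constructor
  · exact fun h => h.of_le C' (fun _ _ => dist_nonneg) fun s _ t _ => by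
      rw [dist_eq_norm]; exact hC' _
  · exact fun h => h.of_le C (fun _ _ => apply_nonneg N _) fun s _ t _ => by
      rw [dist_eq_norm]; exact hC _

end Norms

/-! ### The contact equations as horizontality -/

section Contact

variable {E : Type*} [NormedAddCommGroup E] [NormedSpace ℝ E] [FiniteDimensional ℝ E] {υ : ℕ}
  {br : E →L[ℝ] E →L[ℝ] E} {π : ℕ → E →L[ℝ] E}

/-- The contact equations say that the left logarithmic derivative lies in the first layer. -/
theorem IsGrading.contact_iff (hπ : IsGrading υ br π) {γ : ℝ → E} {a b : ℝ} (hab : a ≤ b)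
    (hγ : AbsolutelyContinuousOnInterval γ a b) :
    (∀ i : ℕ, 2 ≤ i → ∀ᵐ t ∂(volume.restrict (Icc a b)), deriv (fun s => π i (γ s)) t =
      ∑ n ∈ Finset.Icc 2 υ, ((-1 : ℝ) ^ n / (n.factorial : ℝ)) •
        π i ((br (γ t) ^ (n - 1)) (deriv γ t))) ↔
    ∀ᵐ t : ℝ, t ∈ Icc a b → ∀ j, 2 ≤ j →
      π j (negExpPrimitive υ (br (γ t)) 1 (deriv γ t)) = 0 := by
  have hdiff := ae_differentiableAt_of_absolutelyContinuous hγ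
  rw [uIcc_of_le hab] at hdiff
  have key : ∀ t, DifferentiableAt ℝ γ t → ∀ i,
      (deriv (fun s => π i (γ s)) t = ∑ n ∈ Finset.Icc 2 υ,
        ((-1 : ℝ) ^ n / (n.factorial : ℝ)) • π i ((br (γ t) ^ (n - 1)) (deriv γ t)) ↔
      π i (negExpPrimitive υ (br (γ t)) 1 (deriv γ t)) = 0) := by
    intro t ht i
    have h1 : deriv (fun s => π i (γ s)) t = π i (deriv γ t) :=
      ((π i).hasFDerivAt.comp_hasDerivAt t ht.hasDerivAt).deriv
    rw [h1, hπ.negExpPrimitive_apply, map_sub, sub_eq_zero, map_sum]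
    simp only [map_smul]
  constructor
  · intro h
    -- Countably many degrees, so one null set serves all of them.
    have h1 : ∀ᵐ t : ℝ, ∀ i, 2 ≤ i → t ∈ Icc a b → deriv (fun s => π i (γ s)) t =
        ∑ n ∈ Finset.Icc 2 υ, ((-1 : ℝ) ^ n / (n.factorial : ℝ)) •
          π i ((br (γ t) ^ (n - 1)) (deriv γ t)) := by
      rw [ae_all_iff]
      intro i
      by_cases hi : 2 ≤ i
      · filter_upwards [(ae_restrict_iff' measurableSet_Icc).1 (h i hi)] with t ht _ using ht
      · exact Eventually.of_forall fun t h => absurd h hi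
    filter_upwards [h1, hdiff] with t ht hd htm j hj
    exact (key t (hd htm) j).1 (ht j hj htm)
  · intro h i hi
    rw [ae_restrict_iff' measurableSet_Icc]
    filter_upwards [h, hdiff] with t ht hd htm
    exact (key t (hd htm) i).2 (ht htm i hi)

end Contact

/-! ### The equivalence and the length estimate -/

section Curves

variable {E G : Type*} [NormedAddCommGroup E] [NormedSpace ℝ E] [FiniteDimensional ℝ E]
  [TopologicalSpace G] [Group G] [IsTopologicalGroup G] [T2Space G] [ConnectedSpace G]
  {κ : OpenPartialHomeomorph G E} {e : E → G} {υ : ℕ} {π : ℕ → E →L[ℝ] E}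
  {ρ : G → G → ℝ}

namespace IsExponential

variable (he : IsExponential κ e) (hκ : IsIdentityChart κ) (hπ : IsGrading υ (chartBracket κ) π)
  (hρ : IsHomDist π υ e ρ)
include he hκ hπ hρ

theorem exists_dist_le_integral_of_mem : ∃ C > 0, ∀ (γ : ℝ → E) (a b : ℝ), a ≤ b →
    AbsolutelyContinuousOnInterval γ a b →
    (∀ᵐ t : ℝ, t ∈ Icc a b → ∀ j, 2 ≤ j →
      π j (negExpPrimitive υ (chartBracket κ (γ t)) 1 (deriv γ t)) = 0) →
    ∀ s ∈ Icc a b, ∀ t ∈ Icc a b, s ≤ t →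
      ρ (e (γ s)) (e (γ t)) ≤ C * ∫ u in s..t, ‖π 1 (deriv γ u)‖ := by
  obtain ⟨Φ, hΦ⟩ := he.exists_homeomorph hκ hπ hρ
  obtain ⟨C, hC, h⟩ := he.exists_dist_le_integral hκ hπ hΦ hρ
  refine ⟨C, hC, fun γ a b hab hγ hF s hs t ht hst => h γ s t hst (hγ.mono ?_) ?_⟩
  · rw [uIcc_of_le hst, uIcc_of_le hab]
    exact Icc_subset_Icc hs.1 ht.2
  · filter_upwards [hF] with u hu hum using hu (Icc_subset_Icc hs.1 ht.2 hum)

theorem absContWrt_iff {γ : ℝ → E} {a b : ℝ} (hab : a ≤ b) :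
    AbsContWrt ρ (fun t => e (γ t)) a b ↔
      AbsolutelyContinuousOnInterval γ a b ∧ ∀ᵐ t : ℝ, t ∈ Icc a b → ∀ j, 2 ≤ j →
        π j (negExpPrimitive υ (chartBracket κ (γ t)) 1 (deriv γ t)) = 0 := by
  constructor
  · obtain ⟨Φ, hΦ⟩ := he.exists_homeomorph hκ hπ hρ
    exact he.absolutelyContinuous_and_horizontal hκ hπ hΦ hρ hab
  rintro ⟨hγ, hF⟩
  obtain ⟨C, hC, hle⟩ := he.exists_dist_le_integral_of_mem hκ hπ hρ
  have hint : IntervalIntegrable (fun s => ‖π 1 (deriv γ s)‖) volume a b := by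
    have h1 := intervalIntegrable_deriv_of_absolutelyContinuous hγ
    exact ⟨((π 1).integrable_comp h1.1).norm, ((π 1).integrable_comp h1.2).norm⟩
  -- The horizontal arc length is absolutely continuous, and C times its increments dominate ρ along
  -- the curve.
  have hac := hint.absolutelyContinuousOnInterval_intervalIntegral (c := a) left_mem_uIcc
  refine ((absContWrt_dist_iff _ a b).2 hac).of_le C hρ.nonneg ?_
  have key : ∀ s ∈ Icc a b, ∀ t ∈ Icc a b, s ≤ t → ρ (e (γ s)) (e (γ t)) ≤
      C * dist (∫ u in a..s, ‖π 1 (deriv γ u)‖) (∫ u in a..t, ‖π 1 (deriv γ u)‖) := by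
    intro s hs t ht hst
    have hsub : ∀ r ∈ Icc a b, IntervalIntegrable (fun s => ‖π 1 (deriv γ s)‖) volume a r := by
      refine fun r hr => hint.mono_set ?_
      rw [uIcc_of_le hr.1, uIcc_of_le hab]
      exact Icc_subset_Icc_right hr.2
    refine (hle γ a b hab hγ hF s hs t ht hst).trans ?_
    rw [dist_comm, Real.dist_eq, intervalIntegral.integral_interval_sub_left (hsub t ht) (hsub s hs)]
    gcongr
    exact le_abs_self _
  rw [uIcc_of_le hab]
  intro s hs t ht
  rcases le_total s t with hst | hst
  · exact key s hs t ht hst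
  · rw [hρ.symm, dist_comm]
    exact key t ht s hs hst

theorem exists_dist_le_integral_seminorm (N : Seminorm ℝ E) (hN : ∀ X, N X = 0 → X = 0) :
    ∃ C > 0, ∀ (γ : ℝ → E) (a b : ℝ), a ≤ b → AbsContWrt ρ (fun t => e (γ t)) a b →
      ∀ s ∈ Icc a b, ∀ t ∈ Icc a b, s < t →
        ρ (e (γ s)) (e (γ t)) ≤ C * ∫ u in s..t, N (deriv (fun v => π 1 (γ v)) u) := by
  obtain ⟨C, hC, hle⟩ := he.exists_dist_le_integral_of_mem hκ hπ hρ
  obtain ⟨D, hD, hN'⟩ := exists_norm_le_seminorm N hN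
  obtain ⟨D', -, hD'⟩ := exists_seminorm_le_norm N
  refine ⟨C * D, mul_pos hC hD, fun γ a b hab h s hs t ht hst => ?_⟩
  obtain ⟨hγ, hF⟩ := (he.absContWrt_iff hκ hπ hρ hab).1 h
  have hsub : Icc s t ⊆ Icc a b := Icc_subset_Icc hs.1 ht.2
  have hγ' := hγ.mono (c := s) (d := t) (by rwa [uIcc_of_le hst.le, uIcc_of_le hab])
  have h1 := intervalIntegrable_deriv_of_absolutelyContinuous hγ'
  have hint : IntervalIntegrable (fun u => π 1 (deriv γ u)) volume s t :=
    ⟨(π 1).integrable_comp h1.1, (π 1).integrable_comp h1.2⟩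
  have hintN : IntervalIntegrable (fun u => N (π 1 (deriv γ u))) volume s t := by
    refine (hint.norm.const_mul D').mono_fun
      ((continuous_seminorm N).comp_aestronglyMeasurable (by
        rw [uIoc_of_le hst.le]
        exact hint.1.aestronglyMeasurable)) ?_
    refine Eventually.of_forall fun u => ?_
    simp only
    rw [Real.norm_of_nonneg (apply_nonneg N _)]
    exact (hD' _).trans (Real.le_norm_self _)
  have hcongr : ∫ u in s..t, N (deriv (fun v => π 1 (γ v)) u) =
      ∫ u in s..t, N (π 1 (deriv γ u)) := by
    refine intervalIntegral.integral_congr_ae ?_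
    filter_upwards [ae_differentiableAt_of_absolutelyContinuous hγ'] with u hd hu
    have h2 : deriv (fun v => π 1 (γ v)) u = π 1 (deriv γ u) :=
      ((π 1).hasFDerivAt.comp_hasDerivAt u (hd (uIoc_subset_uIcc hu)).hasDerivAt).deriv
    rw [h2]
  rw [hcongr, mul_assoc, ← intervalIntegral.integral_const_mul D]
  refine (hle γ a b hab hγ hF s hs t ht hst.le).trans ?_
  gcongr
  exact intervalIntegral.integral_mono_on hst.le hint.norm (hintN.const_mul D) fun u _ => hN' _

end IsExponential

end Curves

/-! ### Projections of a graded Lie algebra -/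

section LayerProj

variable {L : Type*} [LieRing L] [LieAlgebra ℝ L] (V : ℕ → Submodule ℝ L) [GradedLieAlgebra V]

theorem layerProj_add (i : ℕ) (X Y : L) :
    layerProj V i (X + Y) = layerProj V i X + layerProj V i Y := by
  simp [layerProj, DirectSum.decompose_add]

theorem layerProj_smul (i : ℕ) (r : ℝ) (X : L) :
    layerProj V i (r • X) = r • layerProj V i X := by
  simp only [layerProj, DirectSum.decompose_smul]
  rfl

theorem layerProj_sum {ι : Type*} (i : ℕ) (s : Finset ι) (f : ι → L) :
    layerProj V i (∑ k ∈ s, f k) = ∑ k ∈ s, layerProj V i (f k) :=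
  map_sum (⟨⟨layerProj V i, by simp [layerProj]⟩, layerProj_add V i⟩ : L →+ L) f s

theorem layerProj_mem (i : ℕ) (X : L) : layerProj V i X ∈ V i :=
  (DirectSum.decompose V X i).2

variable {V}

theorem layerProj_of_mem {i : ℕ} {X : L} (hX : X ∈ V i) : layerProj V i X = X :=
  DirectSum.decompose_of_mem_same V hX

theorem layerProj_of_mem_ne {i j : ℕ} {X : L} (hX : X ∈ V i) (h : i ≠ j) :
    layerProj V j X = 0 :=
  DirectSum.decompose_of_mem_ne V hX h

variable {υ : ℕ} (hV : ∀ i, i ∉ Finset.Icc 1 υ → V i = ⊥)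
include hV

theorem layerProj_eq_zero {i : ℕ} (hi : i ∉ Finset.Icc 1 υ) (X : L) : layerProj V i X = 0 := by
  have h := layerProj_mem V i X
  rwa [hV i hi, Submodule.mem_bot] at h

theorem sum_layerProj_of_subset {s : Finset ℕ} (hs : Finset.Icc 1 υ ⊆ s) (X : L) :
    ∑ i ∈ s, layerProj V i X = X := by
  classical
  conv_rhs => rw [← DirectSum.sum_support_decompose V X]
  symm
  refine Finset.sum_subset (fun i hi => hs ?_) fun i _ hi => ?_
  · by_contra h
    rw [DFinsupp.mem_support_iff] at hi
    exact hi (Subtype.ext (layerProj_eq_zero hV h X))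
  · rw [DFinsupp.notMem_support_iff] at hi
    exact congrArg Subtype.val hi

theorem layerProj_bracket (j : ℕ) (X Y : L) : layerProj V j ⁅X, Y⁆ =
    ∑ p ∈ Finset.HasAntidiagonal.antidiagonal j, ⁅layerProj V p.1 X, layerProj V p.2 Y⁆ := by
  -- Large enough to contain all layers and every pair of degrees with sum j, so that filtering
  -- leaves exactly the antidiagonal.
  let s := Finset.range (max υ j + 1)
  have hs : Finset.Icc 1 υ ⊆ s := fun i hi => by
    have := Finset.mem_Icc.1 hi
    simp only [s, Finset.mem_range]
    omega
  have h1 : ⁅X, Y⁆ = ∑ p ∈ s ×ˢ s, ⁅layerProj V p.1 X, layerProj V p.2 Y⁆ := by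
    conv_lhs => rw [← sum_layerProj_of_subset hV hs X, ← sum_layerProj_of_subset hV hs Y]
    rw [sum_lie_sum, Finset.sum_product]
  have h2 : ∀ p : ℕ × ℕ, layerProj V j ⁅layerProj V p.1 X, layerProj V p.2 Y⁆ =
      if p.1 + p.2 = j then ⁅layerProj V p.1 X, layerProj V p.2 Y⁆ else 0 := by
    intro p
    have hm : ⁅layerProj V p.1 X, layerProj V p.2 Y⁆ ∈ V (p.1 + p.2) :=
      SetLike.GradedBracket.bracket_mem (layerProj_mem V _ X) (layerProj_mem V _ Y)
    split_ifs with h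
    · exact layerProj_of_mem (h ▸ hm)
    · exact layerProj_of_mem_ne hm h
  rw [h1, layerProj_sum, Finset.sum_congr rfl fun p _ => h2 p, ← Finset.sum_filter]
  refine Finset.sum_congr ?_ fun _ _ => rfl
  ext p
  simp only [s, Finset.mem_filter, Finset.mem_product, Finset.mem_range,
    Finset.HasAntidiagonal.mem_antidiagonal]
  omega

end LayerProj

/-! ### The Lie group as an instance of the chart setting -/

section Bridge

variable {E : Type*} [NormedAddCommGroup E] [NormedSpace ℝ E] [CompleteSpace E]
  {G : Type*} [TopologicalSpace G] [ChartedSpace E G] [Group G] [LieGroup 𝓘(ℝ, E) ∞ G]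

theorem isExponential_expMap [T2Space G] :
    IsExponential (idChart E G) (expMap (E := E) (G := G)) where
  add_smul := expMap_add_smul
  hasDerivAt := hasDerivAt_idChart_expMap
  continuousAt X := (isMIntegralCurve_expMap X 0).continuousAt

theorem chartBracket_apply (X Y : E) : chartBracket (idChart E G) X Y =
    Bracket.bracket (L := GroupLieAlgebra 𝓘(ℝ, E) G) (M := GroupLieAlgebra 𝓘(ℝ, E) G) X Y :=
  (bracket_eq_chartBracket isIdentityChart_idChart.hasFDerivAt_leftDeriv.differentiableAt X Y).symm

theorem chartBracket_pow_apply (X Y : E) (k : ℕ) : (chartBracket (idChart E G) X ^ k) Y =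
    iterBracket (L := GroupLieAlgebra 𝓘(ℝ, E) G) X Y k := by
  induction k with
  | zero => rfl
  | succ k ih =>
    have h1 := congrArg (chartBracket (idChart E G) X) ih
    rw [pow_succ']
    refine (h1.trans (chartBracket_apply X _)).trans ?_
    exact (Function.iterate_succ_apply' _ _ _).symm

variable [FiniteDimensional ℝ E] (V : ℕ → Submodule ℝ (GroupLieAlgebra 𝓘(ℝ, E) G))
  [GradedLieAlgebra V]

/-- The projections onto the layers as continuous linear maps of the model space. -/
noncomputable def layerMap (i : ℕ) : E →L[ℝ] E :=
  LinearMap.toContinuousLinearMap (E := E) (F' := E)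
    { toFun := fun X => layerProj (L := GroupLieAlgebra 𝓘(ℝ, E) G) V i X
      map_add' := fun X Y => layerProj_add V i X Y
      map_smul' := fun r X => layerProj_smul V i r X }

variable {V} {υ : ℕ}

theorem isGrading_layerMap (hV : ∀ i, i ∉ Finset.Icc 1 υ → V i = ⊥) :
    IsGrading υ (chartBracket (idChart E G)) (layerMap V) where
  bracket j X Y := by
    refine (congrArg (layerMap V j) (chartBracket_apply X Y)).trans ?_
    refine (layerProj_bracket hV j X Y).trans ?_
    exact Finset.sum_congr rfl fun p _ =>
      (chartBracket_apply (E := E) (G := G) (layerMap V p.1 X) (layerMap V p.2 Y)).symm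
  sum X := sum_layerProj_of_subset hV subset_rfl X
  proj_self i X := layerProj_of_mem (L := GroupLieAlgebra 𝓘(ℝ, E) G) (layerProj_mem V i X)
  proj_of_ne i j X h :=
    layerProj_of_mem_ne (L := GroupLieAlgebra 𝓘(ℝ, E) G) (layerProj_mem V j X) h.symm
  eq_zero i hi := ContinuousLinearMap.ext fun X => layerProj_eq_zero hV hi X

theorem IsHomogeneousDistance.isHomDist {ρ : G → G → ℝ} (hρ : IsHomogeneousDistance V υ ρ) :
    IsHomDist (layerMap V) υ expMap ρ where
  eq_zero_iff := hρ.eq_zero_iff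
  symm := hρ.symm
  triangle := hρ.triangle
  continuous := hρ.continuous
  left_invariant := hρ.left_invariant
  homogeneous := hρ.homogeneous

end Bridge

end GradedGroup

theorem mainTheorem9
    {E : Type*} [NormedAddCommGroup E] [NormedSpace ℝ E] [FiniteDimensional ℝ E] [CompleteSpace E]
    {G : Type*} [TopologicalSpace G] [ChartedSpace E G] [Group G] [LieGroup 𝓘(ℝ, E) ∞ G]
    [T2Space G] [SimplyConnectedSpace G]
    (V : ℕ → Submodule ℝ (GroupLieAlgebra 𝓘(ℝ, E) G)) [GradedLieAlgebra V]
    (υ : ℕ) (hV : ∀ i, i ∉ Finset.Icc 1 υ → V i = ⊥)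
    (ρ : G → G → ℝ) (hρ : GradedGroup.IsHomogeneousDistance V υ ρ)
    (N : Seminorm ℝ (GroupLieAlgebra 𝓘(ℝ, E) G)) (hN : ∀ X, N X = 0 → X = 0) :
    (∀ (a b : ℝ), a ≤ b → ∀ (Γ : ℝ → G) (γ : ℝ → GroupLieAlgebra 𝓘(ℝ, E) G),
      (∀ t ∈ Icc a b, Γ t = GradedGroup.lieExp (γ t)) →
        (GradedGroup.AbsContWrt ρ Γ a b ↔
          GradedGroup.AbsContWrt (fun X Y => N (X - Y)) γ a b ∧
            GradedGroup.ContactEquations V υ γ a b)) ∧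
    ∃ C : ℝ, 0 < C ∧
      ∀ (a b : ℝ), a ≤ b → ∀ (Γ : ℝ → G) (γ : ℝ → GroupLieAlgebra 𝓘(ℝ, E) G),
        (∀ t ∈ Icc a b, Γ t = GradedGroup.lieExp (γ t)) →
        (GradedGroup.AbsContWrt ρ Γ a b ∨
          (GradedGroup.AbsContWrt (fun X Y => N (X - Y)) γ a b ∧
            GradedGroup.ContactEquations V υ γ a b)) →
        ∀ τ₁ ∈ Icc a b, ∀ τ₂ ∈ Icc a b, τ₁ < τ₂ →
          ρ (Γ τ₁) (Γ τ₂) ≤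
            C * ∫ t in τ₁..τ₂, N (deriv (fun s => GradedGroup.layerProj V 1 (γ s)) t) := by

  have hG : IsTopologicalGroup G := topologicalGroup_of_lieGroup 𝓘(ℝ, E) ∞
  have he := GradedGroup.isExponential_expMap (E := E) (G := G)
  have hκ := GradedGroup.isIdentityChart_idChart (E := E) (G := G)
  have hπ := GradedGroup.isGrading_layerMap hV
  have hρ' := hρ.isHomDist
  let N' : Seminorm ℝ E := N
  -- Γ agrees with exp ∘ γ only on [a, b]; absolute continuity there does not see other values.
  have hcongr : ∀ (a b : ℝ), a ≤ b → ∀ (Γ : ℝ → G) (γ : ℝ → E),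
      (∀ t ∈ Icc a b, Γ t = GradedGroup.expMap (γ t)) →
      (GradedGroup.AbsContWrt ρ Γ a b ↔
        GradedGroup.AbsContWrt ρ (fun t => GradedGroup.expMap (γ t)) a b) := by
    intro a b hab Γ γ h
    rw [← uIcc_of_le hab] at h
    constructor <;> refine fun hΓ => hΓ.of_le 1 hρ'.nonneg fun s hs t ht => ?_ <;>
      rw [h s hs, h t ht, one_mul]
  have hiff : ∀ (a b : ℝ), a ≤ b → ∀ (Γ : ℝ → G) (γ : ℝ → E),
      (∀ t ∈ Icc a b, Γ t = GradedGroup.expMap (γ t)) →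
      (GradedGroup.AbsContWrt ρ Γ a b ↔ GradedGroup.AbsContWrt (fun X Y => N' (X - Y)) γ a b ∧
        GradedGroup.ContactEquations V υ γ a b) := by
    intro a b hab Γ γ h
    rw [hcongr a b hab Γ γ h, he.absContWrt_iff hκ hπ hρ' hab,
      GradedGroup.absContWrt_seminorm_iff N' hN]
    refine and_congr_right fun hγ => ?_
    rw [← hπ.contact_iff hab hγ]
    simp only [GradedGroup.chartBracket_pow_apply]
    exact Iff.rfl
  refine ⟨hiff, ?_⟩
  obtain ⟨C, hC, hle⟩ := he.exists_dist_le_integral_seminorm hκ hπ hρ' N' hN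
  refine ⟨C, hC, fun a b hab Γ γ h hor s hs t ht hst => ?_⟩
  have hΓ : GradedGroup.AbsContWrt ρ Γ a b := hor.elim id (hiff a b hab Γ γ h).2
  rw [h s hs, h t ht]
  exact hle γ a b hab ((hcongr a b hab Γ γ h).1 hΓ) s hs t ht hst
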